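/- Let $(M,\otimes,I)$ be a small monoidal category (for instance a strict one), let $y(I)=M(I,-)$, and equip $[M,\mathbf{Set}]$ with Day convolution. An $[M,\mathbf{Set}]$-category $\mathcal C$ has hom-functors $\mathcal C(X,Y):M\to\mathbf{Set}$, identities $1_X\in\mathcal C(X,X)I$ and natural, unital, associative compositions $\mathcal C(Y,Z)m_1\times\mathcal C(X,Y)m_2\to\mathcal C(X,Z)(m_1\otimes m_2)$. Let $\mathcal N_M$ be the $[M,\mathbf{Set}]$-category with objects $\underline n=n\cdot y(I)$ ($n\in\mathbb N$) and $\mathcal N_M(\underline n,\underline{n'})m=[M,\mathbf{Set}](\underline{n'},\underline n(-\otimes m))$. An *$M$-graded Lawvere theory* $(\mathcal L,J)$ consists of an $[M,\mathbf{Set}]$-category $\mathcal L$ with cotensors by all $\underline n$ and an identity-on-objects $[M,\mathbf{Set}]$-functor $J:\mathcal N_M\to\mathcal L$ preserving these cotensors; a morphism $(\mathcal L,J)\to(\mathcal L',J')$ is an $[M,\mathbf{Set}]$-functor $F$ with $FJ=J'$. Let $\mathbf{GLaw}_M$ be the resulting category. Let $\mathbf{GMnd}_M$ be the category of finitary $M$-graded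 monads on $\mathbf{Set}$, i.e. lax monoidal functors $T=(\ast,\eta,\mu)$ from $M$ to the category $[\mathbf{Set},\mathbf{Set}]_f$ of filtered-colimit-preserving endofunctors with composition as tensor product (so $\eta_X:X\to I\ast X$ and $\mu_{m_1,m_2,X}:m_1\ast(m_2\ast X)\to(m_1\otimes m_2)\ast X$), and monoidal natural transformations. For $T\in\mathbf{GMnd}_M$ let $\mathcal L_T$ be the graded Lawvere theory with $\mathcal L_T(n,n')m=\mathbf{Set}(n',m\ast n)$, identities $\eta_n$, composition $f\circ g=\mu\circ(m_1\ast g)\circ f$ (for $f$ of grade $m_1$), and $i$-th projection $\eta(i)$; that is, the full sub-$[M,\mathbf{Set}]$-category on the natural numbers of the opposite of the Kleisli-like enriched category of $T$. For $\alpha:T\to T'$ let $\mathcal L_\alpha$ be composition with the components $\alpha_{m,n}$. **Theorem.** The functor $\mathcal L_{(-)}:\mathbf{GMnd}_M\to\mathbf{GLaw}_M$ is full, faithful and essentially surjective; hence the categories $\mathbf{GLaw}_M$ and $\mathbf{GMnd}_M$ are equivalent. Moreover, $\mathcal L_{(-)}$ has an inverse equivalence that sends each $\mathcal L\in\mathbf{GLaw}_M$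 to a finitary graded monad $T_{\mathcal L}$ with $$m\ast X=\int^{n\in\aleph_0}\mathcal L(\underline n,\underline 1)m\times X^n$$ (functorially in $m$ and $X$), where $\aleph_0$ is the full subcategory of $\mathbf{Set}$ on the natural numbers and $\kappa_n:\mathcal L(\underline n,\underline 1)m\times X^n\to m\ast X$ are the coend injections; its unit is $\eta(x)=\kappa_1(1_{\underline 1},x)$ and its multiplication is substitution of terms, $\mu\big(\kappa_n(f,(\kappa_k(\pi_i\circ g,x))_{i=1}^{n})\big)=\kappa_k(f\circ g,x)$ for $f\in\mathcal L(\underline n,\underline 1)m_1$, $g\in\mathcal L(\underline k,\underline n)m_2$, $x\in X^k$, where $\pi_i\in\mathcal L(\underline n,\underline 1)I$ is the $i$-th projection. -/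

import Mathlib

open CategoryTheory MonoidalCategory Limits Opposite

universe u v v'

namespace GradedTheory

section GradedMonads

attribute [local instance] endofunctorMonoidalCategory

/-- An endofunctor of `Set` is finitary if it preserves filtered colimits. -/
def finitary : ObjectProperty (Type u ⥤ Type u) := fun F => PreservesFilteredColimits F

instance : (finitary.{u}).IsMonoidal where
  prop_unit := by
    change PreservesFilteredColimits (𝟭 (Type u)); infer_instance
  prop_tensor F G hF hG := by
    have : PreservesFilteredColimits F := hF
    have : PreservesFilteredColimits G := hG
    change PreservesFilteredColimits (F ⋙ G); infer_instance

/-- The monoidal category `[Set, Set]_f` of finitary endofunctors of `Set`, with `F ⊗ G = F ∘ G`.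
Mathlib's tensor product of endofunctors is `F ⋙ G = G ∘ F`, hence the monoidal opposite. -/
abbrev FinEnd : Type (u + 1) := (finitary.{u}.FullSubcategory)ᴹᵒᵖ

/-- Finitary `M`-graded monads on `Set`, with monoidal natural transformations. -/
abbrev GMnd (M : Type u) [SmallCategory M] [MonoidalCategory M] : Type (u + 1) :=
  LaxMonoidalFunctor M FinEnd.{u}

variable {M : Type u} [SmallCategory M] [MonoidalCategory M]

namespace GMnd

open Functor.LaxMonoidal

/-- The endofunctor `m * (-)`. -/
def act (T : GMnd M) (m : M) : Type u ⥤ Type u := (T.toFunctor.obj m).unmop.obj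

/-- The natural transformation `w * (-)`. -/
def coerce (T : GMnd M) {m m' : M} (w : m ⟶ m') : T.act m ⟶ T.act m' :=
  (T.toFunctor.map w).unmop.hom

/-- The unit `X → I * X`. -/
def unit (T : GMnd M) (X : Type u) : X ⟶ (T.act (𝟙_ M)).obj X :=
  NatTrans.app (F := 𝟭 (Type u)) (ε T.toFunctor).unmop.hom X

/-- The multiplication `m₁ * (m₂ * X) → (m₁ ⊗ m₂) * X`. -/
def mult (T : GMnd M) (m₁ m₂ : M) (X : Type u) :
    (T.act m₁).obj ((T.act m₂).obj X) ⟶ (T.act (m₁ ⊗ m₂)).obj X :=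
  NatTrans.app (F := T.act m₂ ⋙ T.act m₁) (μ T.toFunctor m₁ m₂).unmop.hom X

/-- The component `m * X → m *' X` of a morphism of graded monads. -/
def component {T T' : GMnd M} (α : T ⟶ T') (m : M) : T.act m ⟶ T'.act m :=
  (α.hom.app m).unmop.hom

variable (T : GMnd M)

lemma coerce_id (m : M) : T.coerce (𝟙 m) = 𝟙 _ := by
  unfold coerce; rw [T.toFunctor.map_id]; rfl

lemma coerce_comp {m m' m'' : M} (w : m ⟶ m') (w' : m' ⟶ m'') :
    T.coerce (w ≫ w') = T.coerce w ≫ T.coerce w' := by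
  unfold coerce; rw [T.toFunctor.map_comp]; rfl

lemma unit_naturality {X Y : Type u} (f : X ⟶ Y) :
    f ≫ T.unit Y = T.unit X ≫ (T.act (𝟙_ M)).map f :=
  NatTrans.naturality (F := 𝟭 (Type u)) (ε T.toFunctor).unmop.hom f

lemma mult_naturality (m₁ m₂ : M) {X Y : Type u} (f : X ⟶ Y) :
    (T.act m₁).map ((T.act m₂).map f) ≫ T.mult m₁ m₂ Y =
      T.mult m₁ m₂ X ≫ (T.act (m₁ ⊗ m₂)).map f :=
  NatTrans.naturality (F := T.act m₂ ⋙ T.act m₁) (μ T.toFunctor m₁ m₂).unmop.hom f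

lemma mult_coerce {m₁ m₁' m₂ m₂' : M} (w₁ : m₁ ⟶ m₁') (w₂ : m₂ ⟶ m₂') (X : Type u) :
    (T.coerce w₁).app _ ≫ (T.act m₁').map ((T.coerce w₂).app X) ≫ T.mult m₁' m₂' X =
      T.mult m₁ m₂ X ≫ (T.coerce (w₁ ⊗ₘ w₂)).app X := by
  have h := μ_natural T.toFunctor w₁ w₂
  have h' := congrArg (fun k => NatTrans.app (InducedCategory.Hom.hom (Quiver.Hom.unmop k)) X) h
  exact h'

lemma mult_unit (m : M) (X : Type u) :
    (T.act m).map (T.unit X) ≫ T.mult m (𝟙_ M) X ≫ (T.coerce (ρ_ m).hom).app X = 𝟙 _ := by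
  have h := right_unitality T.toFunctor m
  have h' := congrArg (fun k => NatTrans.app (InducedCategory.Hom.hom (Quiver.Hom.unmop k)) X) h
  exact h'.symm

lemma unit_mult (m : M) (X : Type u) :
    T.unit ((T.act m).obj X) ≫ T.mult (𝟙_ M) m X ≫ (T.coerce (λ_ m).hom).app X = 𝟙 _ := by
  have h := left_unitality T.toFunctor m
  have h' := congrArg (fun k => NatTrans.app (InducedCategory.Hom.hom (Quiver.Hom.unmop k)) X) h
  exact h'.symm

lemma mult_assoc (m₁ m₂ m₃ : M) (X : Type u) :
    T.mult m₁ m₂ ((T.act m₃).obj X) ≫ T.mult (m₁ ⊗ m₂) m₃ X ≫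
        (T.coerce (α_ m₁ m₂ m₃).hom).app X =
      (T.act m₁).map (T.mult m₂ m₃ X) ≫ T.mult m₁ (m₂ ⊗ m₃) X := by
  have h := associativity T.toFunctor m₁ m₂ m₃
  have h' := congrArg (fun k => NatTrans.app (InducedCategory.Hom.hom (Quiver.Hom.unmop k)) X) h
  exact h'

variable {T} {T' : GMnd M} (α : T ⟶ T')

lemma component_coerce {m m' : M} (w : m ⟶ m') :
    T.coerce w ≫ component α m' = component α m ≫ T'.coerce w := by
  have h := α.hom.naturality w
  exact congrArg (fun k => InducedCategory.Hom.hom (Quiver.Hom.unmop k)) h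

lemma component_unit (X : Type u) :
    T.unit X ≫ (component α (𝟙_ M)).app X = T'.unit X := by
  have h := NatTrans.IsMonoidal.unit (τ := α.hom)
  have h' := congrArg (fun k => NatTrans.app (InducedCategory.Hom.hom (Quiver.Hom.unmop k)) X) h
  exact h'

lemma component_mult (m₁ m₂ : M) (X : Type u) :
    T.mult m₁ m₂ X ≫ (component α (m₁ ⊗ m₂)).app X =
      (component α m₁).app _ ≫ (T'.act m₁).map ((component α m₂).app X) ≫ T'.mult m₁ m₂ X := by
  have h := NatTrans.IsMonoidal.tensor (τ := α.hom) m₁ m₂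
  have h' := congrArg (fun k => NatTrans.app (InducedCategory.Hom.hom (Quiver.Hom.unmop k)) X) h
  exact h'

end GMnd
end GradedMonads

section EnrichedCategories

/-- An `[M, Set]`-enriched category (for Day convolution), in elementary terms: by the universal
property of Day convolution and the Yoneda lemma, composition `C(Y, Z) ⊗ C(X, Y) ⟶ C(X, Z)` and
identities `y(I) ⟶ C(X, X)` amount to the data below. `Hom X Y` is a
functor `M ⥤ Type u` whose value at `m` is the set of morphisms of grade `m`, and the composite of
`g` of grade `m₁` after `f` of grade `m₂` has grade `m₁ ⊗ m₂`. -/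
structure EnrCat (M : Type u) [SmallCategory M] [MonoidalCategory M] (Ob : Type v) where
  Hom : Ob → Ob → (M ⥤ Type u)
  one : ∀ X : Ob, (Hom X X).obj (𝟙_ M)
  comp : ∀ {X Y Z : Ob} {m₁ m₂ : M},
    (Hom Y Z).obj m₁ → (Hom X Y).obj m₂ → (Hom X Z).obj (m₁ ⊗ m₂)
  comp_natural : ∀ {X Y Z : Ob} {m₁ m₁' m₂ m₂' : M} (w₁ : m₁ ⟶ m₁') (w₂ : m₂ ⟶ m₂')
    (g : (Hom Y Z).obj m₁) (f : (Hom X Y).obj m₂),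
    comp ((Hom Y Z).map w₁ g) ((Hom X Y).map w₂ f) = (Hom X Z).map (w₁ ⊗ₘ w₂) (comp g f)
  one_comp : ∀ {X Y : Ob} {m : M} (f : (Hom X Y).obj m),
    (Hom X Y).map (λ_ m).hom (comp (one Y) f) = f
  comp_one : ∀ {X Y : Ob} {m : M} (f : (Hom X Y).obj m),
    (Hom X Y).map (ρ_ m).hom (comp f (one X)) = f
  assoc : ∀ {X Y Z W : Ob} {m₁ m₂ m₃ : M} (h : (Hom Z W).obj m₃) (g : (Hom Y Z).obj m₂)
    (f : (Hom X Y).obj m₁),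
    (Hom X W).map (α_ m₃ m₂ m₁).hom (comp (comp h g) f) = comp h (comp g f)

variable {M : Type u} [SmallCategory M] [MonoidalCategory M]

/-- The full enriched subcategory on the objects `i a`, `a : Ob'`. -/
def EnrCat.restrict {Ob : Type v} {Ob' : Type v'} (A : EnrCat M Ob) (i : Ob' → Ob) :
    EnrCat M Ob' where
  Hom X Y := A.Hom (i X) (i Y)
  one X := A.one (i X)
  comp g f := A.comp g f
  comp_natural := A.comp_natural
  one_comp := A.one_comp
  comp_one := A.comp_one
  assoc := A.assoc

/-- An `[M, Set]`-enriched functor. -/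
structure EnrFunctor {Ob : Type v} {Ob' : Type v'} (A : EnrCat M Ob) (B : EnrCat M Ob') where
  obj : Ob → Ob'
  map : ∀ X Y : Ob, A.Hom X Y ⟶ B.Hom (obj X) (obj Y)
  map_one : ∀ X : Ob, (map X X).app (𝟙_ M) (A.one X) = B.one (obj X)
  map_comp : ∀ {X Y Z : Ob} {m₁ m₂ : M} (g : (A.Hom Y Z).obj m₁) (f : (A.Hom X Y).obj m₂),
    (map X Z).app (m₁ ⊗ m₂) (A.comp g f) = B.comp ((map Y Z).app m₁ g) ((map X Y).app m₂ f)

/-- An identity-on-objects `[M, Set]`-enriched functor. -/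
@[ext]
structure IdObjFunctor {Ob : Type v} (A B : EnrCat M Ob) where
  map : ∀ X Y : Ob, A.Hom X Y ⟶ B.Hom X Y
  map_one : ∀ X : Ob, (map X X).app (𝟙_ M) (A.one X) = B.one X
  map_comp : ∀ {X Y Z : Ob} {m₁ m₂ : M} (g : (A.Hom Y Z).obj m₁) (f : (A.Hom X Y).obj m₂),
    (map X Z).app (m₁ ⊗ m₂) (A.comp g f) = B.comp ((map Y Z).app m₁ g) ((map X Y).app m₂ f)

namespace IdObjFunctor

/-- An identity-on-objects functor as an enriched functor. -/
def toEnrFunctor {Ob : Type v} {A B : EnrCat M Ob} (F : IdObjFunctor A B) : EnrFunctor A B where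
  obj X := X
  map := F.map
  map_one := F.map_one
  map_comp := F.map_comp

/-- The identity functor. -/
def id {Ob : Type v} (A : EnrCat M Ob) : IdObjFunctor A A where
  map X Y := 𝟙 (A.Hom X Y)
  map_one _ := rfl
  map_comp _ _ := rfl

/-- The composite: first `F`, then `G`. -/
def comp {Ob : Type v} {A B C : EnrCat M Ob} (F : IdObjFunctor A B) (G : IdObjFunctor B C) :
    IdObjFunctor A C where
  map X Y := F.map X Y ≫ G.map X Y
  map_one X := by simp [F.map_one, G.map_one]
  map_comp g f := by simp [F.map_comp, G.map_comp]

end IdObjFunctor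

/-- The right internal hom `⟦X, F⟧` of `[M, Set]` for Day convolution:
its value at `m` is the set of natural transformations `X ⟶ F(- ⊗ m)`. -/
def rightHom (X F : M ⥤ Type u) : M ⥤ Type u where
  obj m := X ⟶ tensorRight m ⋙ F
  map w := ↾fun φ => φ ≫ Functor.whiskerRight ((curriedTensor M).flip.map w) F
  map_id m := by
    ext φ; simp
  map_comp w w' := by
    ext φ; simp

/-- The component at `p` of an element of `⟦X, F⟧` of grade `m`. -/
def rightHom.ev {X F : M ⥤ Type u} {m : M} (φ : (rightHom X F).obj m) (p : M) (x : X.obj p) :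
    F.obj (p ⊗ m) :=
  NatTrans.app (G := tensorRight m ⋙ F) φ p x

lemma rightHom.ev_map {X F : M ⥤ Type u} {m : M} (φ : (rightHom X F).obj m) {p q : M} (w : p ⟶ q)
    (x : X.obj p) : ev φ q (X.map w x) = F.map (w ▷ m) (ev φ p x) :=
  NatTrans.naturality_apply (G := tensorRight m ⋙ F) φ w x

lemma rightHom.map_ev {X F : M ⥤ Type u} {m m' : M} (w : m ⟶ m') (φ : (rightHom X F).obj m)
    (p : M) (x : X.obj p) : ev ((rightHom X F).map w φ) p x = F.map (p ◁ w) (ev φ p x) :=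
  rfl

lemma rightHom.ext {X F : M ⥤ Type u} {m : M} {φ ψ : (rightHom X F).obj m}
    (h : ∀ (p : M) (x : X.obj p), ev φ p x = ev ψ p x) : φ = ψ :=
  NatTrans.ext (funext fun p => ConcreteCategory.hom_ext _ _ (h p))

/-- An element of `⟦X, F⟧` of grade `m` from its components. -/
def rightHom.mk {X F : M ⥤ Type u} {m : M} (φ : ∀ p : M, X.obj p → F.obj (p ⊗ m))
    (h : ∀ {p q : M} (w : p ⟶ q) (x : X.obj p), φ q (X.map w x) = F.map (w ▷ m) (φ p x)) :
    (rightHom X F).obj m :=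
  NatTrans.mk (G := tensorRight m ⋙ F) (fun p => ↾(φ p))
    (fun _ _ w => ConcreteCategory.hom_ext _ _ (h w))

/-- The `[M, Set]`-category opposite to the enrichment of `[M, Set]ᵗ` over itself (where `ᵗ` reverses
the tensor product): the morphisms `G → H` of grade `m` are the natural transformations
`H ⟶ G(- ⊗ m)`. -/
def selfOp (M : Type u) [SmallCategory M] [MonoidalCategory M] : EnrCat M (M ⥤ Type u) where
  Hom G H := rightHom H G
  one G := rightHom.mk (fun p => G.map (ρ_ p).inv) fun w x => by
    rw [← Functor.map_comp_apply, ← Functor.map_comp_apply, rightUnitor_inv_naturality]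
  comp {G H K m₁ m₂} g f :=
    rightHom.mk (fun p x => G.map (α_ p m₁ m₂).hom (rightHom.ev f _ (rightHom.ev g p x)))
      fun w x => by
        rw [rightHom.ev_map, rightHom.ev_map, ← Functor.map_comp_apply, ← Functor.map_comp_apply,
          associator_naturality_left]
  comp_natural {G H K m₁ m₁' m₂ m₂'} w₁ w₂ g f := by
    refine rightHom.ext fun p x => ?_
    change G.map _ (rightHom.ev ((rightHom H G).map w₂ f) _
      (rightHom.ev ((rightHom K H).map w₁ g) p x)) = G.map _ (G.map _ _)
    rw [rightHom.map_ev, rightHom.map_ev, rightHom.ev_map]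
    simp only [← Functor.map_comp_apply]
    congr 2
    simp [MonoidalCategory.tensorHom_def]
  one_comp {X Y m} f := by
    refine rightHom.ext fun p x => ?_
    change X.map (p ◁ (λ_ m).hom) (X.map _ (rightHom.ev f _ (Y.map _ x))) = _
    rw [rightHom.ev_map]
    simp only [← Functor.map_comp_apply]
    have : (ρ_ p).inv ▷ m ≫ (α_ p (𝟙_ M) m).hom ≫ p ◁ (λ_ m).hom = 𝟙 _ := by simp
    rw [Category.assoc, this]; simp
  comp_one {X Y m} f := by
    refine rightHom.ext fun p x => ?_
    change X.map (p ◁ (ρ_ m).hom) (X.map _ (X.map _ (rightHom.ev f _ x))) = _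
    simp only [← Functor.map_comp_apply]
    have : (ρ_ (p ⊗ m)).inv ≫ (α_ p m (𝟙_ M)).hom ≫ p ◁ (ρ_ m).hom = 𝟙 _ := by simp
    rw [Category.assoc, this]; simp
  assoc {X Y Z W m₁ m₂ m₃} h g f := by
    refine rightHom.ext fun p x => ?_
    change X.map (p ◁ (α_ m₃ m₂ m₁).hom) (X.map _ (rightHom.ev f _ (Y.map _ (rightHom.ev g _ (rightHom.ev h p x))))) =
      X.map _ (X.map _ (rightHom.ev f _ (rightHom.ev g _ (rightHom.ev h p x))))
    rw [rightHom.ev_map]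
    simp only [← Functor.map_comp_apply]
    congr 2
    simp

/-- The `n`-fold coproduct `n · y(I)` of the representable functor `y(I) = M(I, -)`. -/
def copow (M : Type u) [SmallCategory M] [MonoidalCategory M] (n : ℕ) : M ⥤ Type u where
  obj m := Fin n × (𝟙_ M ⟶ m)
  map w := ↾fun x => (x.1, x.2 ≫ w)

/-- The `[M, Set]`-category of arities: its objects are the natural numbers, `n` standing for
`n · y(I)`. -/
def arityCat (M : Type u) [SmallCategory M] [MonoidalCategory M] : EnrCat M ℕ :=
  (selfOp M).restrict (copow M)

/-- The map `f ↦ (x ↦ ν(x) ∘ f)` from `A(B, P)` to `⟦X, A(B, C)⟧` induced by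
`ν : X ⟶ A(P, C)`, at grade `m`. -/
def cotensorMap {Ob : Type v} (A : EnrCat M Ob) {X : M ⥤ Type u} {C P : Ob} (ν : X ⟶ A.Hom P C)
    (B : Ob) (m : M) (f : (A.Hom B P).obj m) : (rightHom X (A.Hom B C)).obj m where
  app p := ↾fun x => A.comp (ν.app p x) f
  naturality p q w := by
    ext x
    have := A.comp_natural w (𝟙 m) (ν.app p x) f
    simpa using this

/-- `P`, with the unit `ν : X ⟶ A(P, C)`, is a cotensor of `C` by `X` in `A`. -/
def IsCotensor {Ob : Type v} (A : EnrCat M Ob) (X : M ⥤ Type u) (C P : Ob) (ν : X ⟶ A.Hom P C) :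
    Prop :=
  ∀ (B : Ob) (m : M), Function.Bijective (cotensorMap A ν B m)

/-- `A` has cotensors by all the arities `n · y(I)`. -/
def HasArityCotensors {Ob : Type v} (A : EnrCat M Ob) : Prop :=
  ∀ (n : ℕ) (C : Ob), ∃ (P : Ob) (ν : copow M n ⟶ A.Hom P C), IsCotensor A (copow M n) C P ν

/-- `F` preserves cotensors by all the arities `n · y(I)`. -/
def EnrFunctor.PreservesArityCotensors {Ob : Type v} {Ob' : Type v'} {A : EnrCat M Ob}
    {B : EnrCat M Ob'} (F : EnrFunctor A B) : Prop :=
  ∀ (n : ℕ) (C P : Ob) (ν : copow M n ⟶ A.Hom P C), IsCotensor A (copow M n) C P ν →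
    IsCotensor B (copow M n) (F.obj C) (F.obj P) (ν ≫ F.map P C)

section Lemmas

/-- The composite `u ∘ f` where `u` has grade `I`, regarded as having the grade of `f`. -/
def EnrCat.post {Ob : Type v} (A : EnrCat M Ob) {X Y Z : Ob} {m : M} (u : (A.Hom Y Z).obj (𝟙_ M))
    (f : (A.Hom X Y).obj m) : (A.Hom X Z).obj m :=
  (A.Hom X Z).map (λ_ m).hom (A.comp u f)

/-- The composite `f ∘ u` where `u` has grade `I`, regarded as having the grade of `f`. -/
def EnrCat.pre {Ob : Type v} (A : EnrCat M Ob) {X Y Z : Ob} {m : M} (f : (A.Hom Y Z).obj m)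
    (u : (A.Hom X Y).obj (𝟙_ M)) : (A.Hom X Z).obj m :=
  (A.Hom X Z).map (ρ_ m).hom (A.comp f u)

lemma EnrCat.comp_map_left {Ob : Type v} (A : EnrCat M Ob) {X Y Z : Ob} {m₁ m₁' m₂ : M}
    (w : m₁ ⟶ m₁') (g : (A.Hom Y Z).obj m₁) (f : (A.Hom X Y).obj m₂) :
    A.comp ((A.Hom Y Z).map w g) f = (A.Hom X Z).map (w ▷ m₂) (A.comp g f) := by
  simpa using A.comp_natural w (𝟙 m₂) g f

lemma EnrCat.comp_map_right {Ob : Type v} (A : EnrCat M Ob) {X Y Z : Ob} {m₁ m₂ m₂' : M}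
    (w : m₂ ⟶ m₂') (g : (A.Hom Y Z).obj m₁) (f : (A.Hom X Y).obj m₂) :
    A.comp g ((A.Hom X Y).map w f) = (A.Hom X Z).map (m₁ ◁ w) (A.comp g f) := by
  simpa using A.comp_natural (𝟙 m₁) w g f

lemma EnrCat.post_post {Ob : Type v} (A : EnrCat M Ob) {X Y Z W : Ob} {m : M}
    (w : (A.Hom Z W).obj (𝟙_ M)) (u : (A.Hom Y Z).obj (𝟙_ M)) (f : (A.Hom X Y).obj m) :
    A.post w (A.post u f) = A.post (A.post w u) f := by
  simp only [post, comp_map_left, comp_map_right, ← A.assoc, ← Functor.map_comp_apply]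
  have : ((α_ (𝟙_ M) (𝟙_ M) m).hom ≫ 𝟙_ M ◁ (λ_ m).hom) ≫ (λ_ m).hom =
      (λ_ (𝟙_ M)).hom ▷ m ≫ (λ_ m).hom := by
    rw [MonoidalCategory.triangle, unitors_equal]
  rw [this]

lemma EnrCat.pre_pre {Ob : Type v} (A : EnrCat M Ob) {X Y Z W : Ob} {m : M}
    (f : (A.Hom Z W).obj m) (u : (A.Hom Y Z).obj (𝟙_ M)) (w : (A.Hom X Y).obj (𝟙_ M)) :
    A.pre (A.pre f u) w = A.pre f (A.post u w) := by
  simp only [pre, post, comp_map_left, comp_map_right, ← A.assoc, ← Functor.map_comp_apply]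
  congr 2
  simp

lemma EnrFunctor.map_post {Ob : Type v} {Ob' : Type v'} {A : EnrCat M Ob} {B : EnrCat M Ob'}
    (F : EnrFunctor A B) {X Y Z : Ob} {m : M} (u : (A.Hom Y Z).obj (𝟙_ M))
    (f : (A.Hom X Y).obj m) :
    (F.map X Z).app m (A.post u f) = B.post ((F.map Y Z).app _ u) ((F.map X Y).app m f) := by
  rw [EnrCat.post, NatTrans.naturality_apply, F.map_comp]; rfl

/-- The Yoneda lemma for `n · y(I)`. -/
def copowEquiv {n : ℕ} (F : M ⥤ Type u) (m : M) :
    (rightHom (copow M n) F).obj m ≃ (Fin n → F.obj m) where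
  toFun φ i := F.map (λ_ m).hom (rightHom.ev φ (𝟙_ M) (i, 𝟙 _))
  invFun a := rightHom.mk (fun p x => F.map ((λ_ m).inv ≫ x.2 ▷ m) (a x.1)) fun {p q} w x => by
    change F.map ((λ_ m).inv ≫ (x.2 ≫ w) ▷ m) (a x.1) = _
    rw [← Functor.map_comp_apply]; simp
  left_inv φ := rightHom.ext fun p x => by
    obtain ⟨i, w⟩ := x
    change F.map _ (F.map _ (rightHom.ev φ _ _)) = _
    rw [← Functor.map_comp_apply]
    have := rightHom.ev_map φ w (i, 𝟙 _)
    simp only [Iso.hom_inv_id_assoc]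
    rw [← this]
    change rightHom.ev φ p (i, 𝟙 _ ≫ w) = _
    rw [Category.id_comp]
  right_inv a := by
    funext i
    change F.map _ (F.map _ (a i)) = a i
    rw [← Functor.map_comp_apply]; simp

/-- The `i`-th projection determined by a cotensor unit `ν`. -/
def proj {Ob : Type v} {A : EnrCat M Ob} {n : ℕ} {C P : Ob} (ν : copow M n ⟶ A.Hom P C)
    (i : Fin n) : (A.Hom P C).obj (𝟙_ M) :=
  ν.app (𝟙_ M) (i, 𝟙 _)

lemma isCotensor_iff {Ob : Type v} {A : EnrCat M Ob} {n : ℕ} {C P : Ob}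
    (ν : copow M n ⟶ A.Hom P C) :
    IsCotensor A (copow M n) C P ν ↔ ∀ (B : Ob) (m : M), Function.Bijective
      (fun (f : (A.Hom B P).obj m) (i : Fin n) => A.post (proj ν i) f) := by
  refine forall₂_congr fun B m => ?_
  have : (fun (f : (A.Hom B P).obj m) (i : Fin n) => A.post (proj ν i) f) =
      copowEquiv (A.Hom B C) m ∘ cotensorMap A ν B m := rfl
  rw [this, Equiv.comp_bijective]

/-- The unit `n · y(I) ⟶ F` with prescribed values. -/
def copowHom {n : ℕ} {F : M ⥤ Type u} (a : Fin n → F.obj (𝟙_ M)) : copow M n ⟶ F where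
  app p := ↾fun x => F.map x.2 (a x.1)
  naturality p q w := by
    ext x
    change F.map (x.2 ≫ w) (a x.1) = F.map w (F.map x.2 (a x.1))
    simp

lemma proj_copowHom {Ob : Type v} {A : EnrCat M Ob} {n : ℕ} {C P : Ob}
    (a : Fin n → (A.Hom P C).obj (𝟙_ M)) (i : Fin n) : proj (copowHom a) i = a i := by
  change (A.Hom P C).map (𝟙 _) (a i) = a i
  simp

lemma preserves_of_one {Ob : Type v} {Ob' : Type v'} {A : EnrCat M Ob} {B : EnrCat M Ob'}
    (F : EnrFunctor A B) {n : ℕ} {C P P' : Ob} {ν : copow M n ⟶ A.Hom P C}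
    {ν' : copow M n ⟶ A.Hom P' C} (h : IsCotensor A (copow M n) C P ν)
    (h' : IsCotensor A (copow M n) C P' ν')
    (hF : IsCotensor B (copow M n) (F.obj C) (F.obj P) (ν ≫ F.map P C)) :
    IsCotensor B (copow M n) (F.obj C) (F.obj P') (ν' ≫ F.map P' C) := by
  rw [isCotensor_iff] at h h' hF ⊢
  obtain ⟨u, hu⟩ := (h P' (𝟙_ M)).2 (proj ν')
  obtain ⟨w, hw⟩ := (h' P (𝟙_ M)).2 (proj ν)
  have hu i : A.post (proj ν i) u = proj ν' i := congrFun hu i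
  have hw i : A.post (proj ν' i) w = proj ν i := congrFun hw i
  have key : A.post w u = A.one P' := by
    refine (h' P' (𝟙_ M)).1 (funext fun i => ?_)
    change A.post _ _ = A.post _ _
    rw [A.post_post, hw, hu]
    have := A.comp_one (proj ν' i)
    rw [← unitors_equal] at this
    exact this.symm
  have key' : A.post u w = A.one P := by
    refine (h P (𝟙_ M)).1 (funext fun i => ?_)
    change A.post _ _ = A.post _ _
    rw [A.post_post, hu, hw]
    have := A.comp_one (proj ν i)
    rw [← unitors_equal] at this
    exact this.symm
  intro X m
  have e : (fun (f : (B.Hom X (F.obj P')).obj m) (i : Fin n) =>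
      B.post (proj (A := B) (ν' ≫ F.map P' C) i) f) =
      (fun (f : (B.Hom X (F.obj P)).obj m) (i : Fin n) =>
        B.post (proj (A := B) (ν ≫ F.map P C) i) f) ∘ B.post ((F.map P' P).app _ u) := by
    funext f i
    change _ = B.post _ (B.post _ f)
    rw [B.post_post]
    congr 1
    change (F.map P' C).app _ (proj ν' i) = B.post ((F.map P C).app _ (proj ν i)) _
    rw [← F.map_post, hu]
  rw [e]
  refine (hF X m).comp (Function.bijective_iff_has_inverse.2
    ⟨B.post ((F.map P P').app _ w), fun f => ?_, fun f => ?_⟩)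
  · rw [B.post_post, ← F.map_post, key, F.map_one]; exact B.one_comp f
  · rw [B.post_post, ← F.map_post, key', F.map_one]; exact B.one_comp f

end Lemmas

/-- The functor `Set(n, n') → N(n', n) I` from functions to morphisms of arities. -/
def arityMap {n n' : ℕ} (σ : Fin n → Fin n') : ((arityCat M).Hom n' n).obj (𝟙_ M) :=
  (copowEquiv (copow M n') (𝟙_ M)).symm fun i => (σ i, 𝟙 _)

lemma ev_arityMap {n n' : ℕ} (σ : Fin n → Fin n') (p : M) (x : (copow M n).obj p) :
    rightHom.ev (arityMap (M := M) σ) p x = (σ x.1, x.2 ≫ (ρ_ p).inv) := by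
  change (σ x.1, 𝟙 _ ≫ (λ_ (𝟙_ M)).inv ≫ x.2 ▷ 𝟙_ M) = _
  rw [unitors_inv_equal]; simp

lemma copowEquiv_post_arityMap {n n' k : ℕ} (σ : Fin n → Fin n') {m : M}
    (f : ((arityCat M).Hom k n').obj m) :
    copowEquiv (copow M k) m ((arityCat M).post (arityMap σ) f) =
      copowEquiv (copow M k) m f ∘ σ := by
  revert f
  change ∀ f : (rightHom (copow M n') (copow M k)).obj m, _
  intro f
  funext i
  change (copow M k).map (λ_ m).hom ((copow M k).map (𝟙_ M ◁ (λ_ m).hom)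
    ((copow M k).map (α_ (𝟙_ M) (𝟙_ M) m).hom
      (rightHom.ev f _ (rightHom.ev (arityMap (M := M) σ) (𝟙_ M) (i, 𝟙 _))))) =
    (copow M k).map (λ_ m).hom (rightHom.ev f (𝟙_ M) (σ i, 𝟙 _))
  have h := rightHom.ev_map f (ρ_ (𝟙_ M)).inv (σ i, 𝟙 _)
  change rightHom.ev f _ (σ i, 𝟙 _ ≫ (ρ_ (𝟙_ M)).inv) = _ at h
  have h' := (congrArg (rightHom.ev f _) (ev_arityMap (M := M) σ (𝟙_ M) (i, 𝟙 _))).trans h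
  rw [h']
  simp only [← Functor.map_comp_apply]
  congr 3
  simp

lemma arityMap_id (n : ℕ) : arityMap (M := M) (_root_.id : Fin n → Fin n) = (arityCat M).one n := by
  refine rightHom.ext fun p x => ?_
  rw [ev_arityMap]; rfl

lemma arityMap_comp {n n' n'' : ℕ} (σ : Fin n → Fin n') (τ : Fin n' → Fin n'') :
    arityMap (M := M) (τ ∘ σ) = (arityCat M).post (arityMap σ) (arityMap τ) := by
  apply (copowEquiv (copow M n'') (𝟙_ M)).injective
  erw [copowEquiv_post_arityMap]
  simp [arityMap]
  rfl

/-- The standard cotensor of `c` by `n` in `arityCat M`: the object `n * c`. -/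
def arityUnit (M : Type u) [SmallCategory M] [MonoidalCategory M] (n c : ℕ) :
    copow M n ⟶ (arityCat M).Hom (n * c) c :=
  copowHom fun i => arityMap fun j => finProdFinEquiv (i, j)

lemma arityUnit_isCotensor (n c : ℕ) :
    IsCotensor (arityCat M) (copow M n) c (n * c) (arityUnit M n c) := by
  rw [isCotensor_iff]
  intro k m
  let e₁ := copowEquiv (n := n * c) (copow M k) m
  let e₂ := copowEquiv (n := c) (copow M k) m
  let e₃ : (Fin (n * c) → (copow M k).obj m) ≃ (Fin n → Fin c → (copow M k).obj m) :=
    (finProdFinEquiv.symm.arrowCongr (Equiv.refl _)).trans (Equiv.curry _ _ _)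
  have : (fun (f : ((arityCat M).Hom k (n * c)).obj m) (i : Fin n) =>
      (arityCat M).post (proj (arityUnit M n c) i) f) =
      (e₁.trans (e₃.trans (Equiv.piCongrRight fun _ => e₂.symm))) := by
    funext f i
    apply e₂.injective
    erw [proj_copowHom, copowEquiv_post_arityMap]
    exact (e₂.apply_symm_apply _).symm
  rw [this]
  exact Equiv.bijective _

/-- An `M`-graded Lawvere theory: an `[M, Set]`-category with objects the natural numbers and with
cotensors by all arities, together with an identity-on-objects `[M, Set]`-functor `J` from the
category of arities that preserves these cotensors. -/
structure GLaw (M : Type u) [SmallCategory M] [MonoidalCategory M] where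
  cat : EnrCat M ℕ
  hasCotensors : HasArityCotensors cat
  J : IdObjFunctor (arityCat M) cat
  preserves : J.toEnrFunctor.PreservesArityCotensors

/-- A morphism of graded Lawvere theories: an enriched functor commuting with the functors from
`arityCat M`. It is the identity on objects because these functors are. -/
@[ext]
structure GLaw.Hom (L L' : GLaw M) where
  functor : IdObjFunctor L.cat L'.cat
  comm : L.J.comp functor = L'.J

instance : Category (GLaw M) where
  Hom := GLaw.Hom
  id L := ⟨IdObjFunctor.id L.cat, by ext1; funext X Y; exact Category.comp_id _⟩
  comp F G := ⟨F.functor.comp G.functor, by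
    rw [← G.comm, ← F.comm]; ext1; funext X Y; exact (Category.assoc _ _ _).symm⟩
  id_comp F := by
    apply GLaw.Hom.ext; ext1; funext X Y; exact Category.id_comp _
  comp_id F := by
    apply GLaw.Hom.ext; ext1; funext X Y; exact Category.comp_id _
  assoc F G H := by
    apply GLaw.Hom.ext; ext1; funext X Y; exact Category.assoc _ _ _

section LawvereOfMonad

lemma copowEquiv_comp {X Y Z : ℕ} {m₁ m₂ : M} (g : ((arityCat M).Hom Y Z).obj m₁)
    (f : ((arityCat M).Hom X Y).obj m₂) (i : Fin Z) :
    copowEquiv (copow M X) (m₁ ⊗ m₂) ((arityCat M).comp g f) i =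
      ((copowEquiv (copow M X) m₂ f (copowEquiv (copow M Y) m₁ g i).1).1,
        (λ_ (𝟙_ M)).inv ≫ ((copowEquiv (copow M Y) m₁ g i).2 ⊗ₘ
          (copowEquiv (copow M X) m₂ f (copowEquiv (copow M Y) m₁ g i).1).2)) := by
  revert f g
  change ∀ (g : (rightHom (copow M Z) (copow M Y)).obj m₁)
    (f : (rightHom (copow M Y) (copow M X)).obj m₂), _
  intro g f
  change (copow M X).map (λ_ (m₁ ⊗ m₂)).hom ((copow M X).map (α_ (𝟙_ M) m₁ m₂).hom
    (rightHom.ev f _ (rightHom.ev g (𝟙_ M) (i, 𝟙 _)))) = _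
  have h := rightHom.ev_map f (rightHom.ev g (𝟙_ M) (i, 𝟙 _)).2
    ((rightHom.ev g (𝟙_ M) (i, 𝟙 _)).1, 𝟙 _)
  have h₂ : (copow M Y).map (rightHom.ev g (𝟙_ M) (i, 𝟙 _)).2
      ((rightHom.ev g (𝟙_ M) (i, 𝟙 _)).1, 𝟙 _) = rightHom.ev g (𝟙_ M) (i, 𝟙 _) :=
    Prod.ext rfl (Category.id_comp _)
  rw [h₂] at h
  rw [h]
  refine Prod.ext rfl ?_
  let a : 𝟙_ M ⟶ 𝟙_ M ⊗ m₁ := (rightHom.ev g (𝟙_ M) (i, 𝟙 _)).2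
  let b : 𝟙_ M ⟶ 𝟙_ M ⊗ m₂ :=
    (rightHom.ev f (𝟙_ M) ((rightHom.ev g (𝟙_ M) (i, 𝟙 _)).1, 𝟙 _)).2
  change ((b ≫ a ▷ m₂) ≫ (α_ (𝟙_ M) m₁ m₂).hom) ≫ (λ_ (m₁ ⊗ m₂)).hom =
    (λ_ (𝟙_ M)).inv ≫ ((a ≫ (λ_ m₁).hom) ⊗ₘ (b ≫ (λ_ m₂).hom))
  simp [MonoidalCategory.tensorHom_def']

/-- The `[M, Set]`-category opposite to the Kleisli-like `[M, Set]ᵗ`-category of a graded monad: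
morphisms `X → Y` of grade `m` are maps `Y ⟶ m * X`. -/
def kleisliOp (T : GMnd M) : EnrCat M (Type u) where
  Hom X Y :=
    { obj := fun m => (Y ⟶ (T.act m).obj X)
      map := fun w => ↾fun f => f ≫ (T.coerce w).app X
      map_id := fun m => by ext f; simp [T.coerce_id]
      map_comp := fun w w' => by ext f; simp [T.coerce_comp] }
  one X := T.unit X
  comp {X Y Z m₁ m₂} g f := g ≫ (T.act m₁).map f ≫ T.mult m₁ m₂ X
  comp_natural {X Y Z m₁ m₁' m₂ m₂'} w₁ w₂ g f := by
    change (g ≫ (T.coerce w₁).app Y) ≫ (T.act m₁').map (f ≫ (T.coerce w₂).app X) ≫ _ =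
      (g ≫ (T.act m₁).map f ≫ T.mult m₁ m₂ X) ≫ (T.coerce (w₁ ⊗ₘ w₂)).app X
    have h := (T.coerce w₁).naturality f
    simp only [Functor.map_comp, Category.assoc]
    rw [← T.mult_coerce, reassoc_of% h]
  one_comp {X Y m} f := by
    change (T.unit Y ≫ (T.act (𝟙_ M)).map f ≫ T.mult (𝟙_ M) m X) ≫ (T.coerce (λ_ m).hom).app X = f
    have h := T.unit_naturality f
    simp only [Category.assoc]
    rw [← reassoc_of% h, T.unit_mult, Category.comp_id]
  comp_one {X Y m} f := by
    change (f ≫ (T.act m).map (T.unit X) ≫ T.mult m (𝟙_ M) X) ≫ (T.coerce (ρ_ m).hom).app X = f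
    simp only [Category.assoc]
    rw [T.mult_unit, Category.comp_id]
  assoc {X Y Z W m₁ m₂ m₃} h g f := by
    change ((h ≫ (T.act m₃).map g ≫ T.mult m₃ m₂ Y) ≫ (T.act (m₃ ⊗ m₂)).map f ≫
      T.mult (m₃ ⊗ m₂) m₁ X) ≫ (T.coerce (α_ m₃ m₂ m₁).hom).app X =
      h ≫ (T.act m₃).map (g ≫ (T.act m₂).map f ≫ T.mult m₂ m₁ X) ≫ T.mult m₃ (m₂ ⊗ m₁) X
    simp only [Functor.map_comp, Category.assoc]
    rw [← T.mult_assoc, ← reassoc_of% (T.mult_naturality m₃ m₂ f)]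

/-- The full subcategory of `kleisliOp T` on the natural numbers. -/
def lawvereCat (T : GMnd M) : EnrCat M ℕ :=
  (kleisliOp T).restrict fun n : ℕ => ULift.{u} (Fin n)

/-- An element of a hom-object of `lawvereCat T`, as a map. -/
def lawvereCat.toMap {T : GMnd M} {n n' : ℕ} {m : M} (f : ((lawvereCat T).Hom n n').obj m) :
    ULift.{u} (Fin n') ⟶ (T.act m).obj (ULift.{u} (Fin n)) :=
  f

lemma lawvereCat.ext {T : GMnd M} {n n' : ℕ} {m : M} {f g : ((lawvereCat T).Hom n n').obj m}
    (h : ∀ i : ULift.{u} (Fin n'), toMap f i = toMap g i) : f = g :=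
  ConcreteCategory.hom_ext (toMap f) (toMap g) h

/-- The value of a variable `i`, coerced along `w : I ⟶ m`. -/
def var (T : GMnd M) {m : M} {n : ℕ} (x : (copow M n).obj m) :
    (T.act m).obj (ULift.{u} (Fin n)) :=
  (T.coerce x.2).app _ (T.unit _ ⟨x.1⟩)

lemma var_map (T : GMnd M) {m m' : M} (w : m ⟶ m') {n : ℕ} (x : (copow M n).obj m) :
    var T ((copow M n).map w x) = (T.coerce w).app _ (var T x) := by
  change (T.coerce (x.2 ≫ w)).app _ _ = _
  rw [T.coerce_comp]; rfl

lemma GMnd.mult_unit_unit (T : GMnd M) {m₁ m₂ : M} (a : 𝟙_ M ⟶ m₁) (b : 𝟙_ M ⟶ m₂) {A B : Type u}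
    (k : A ⟶ (T.act m₂).obj B) (j : A) (y : B) (hk : k j = (T.coerce b).app B (T.unit B y)) :
    T.mult m₁ m₂ B ((T.act m₁).map k ((T.coerce a).app A (T.unit A j))) =
      (T.coerce ((λ_ (𝟙_ M)).inv ≫ (a ⊗ₘ b))).app B (T.unit B y) := by
  have h₁ := (T.coerce a).naturality_apply k (T.unit A j)
  have h₂ : T.unit _ (k j) = (T.act (𝟙_ M)).map k (T.unit A j) :=
    ConcreteCategory.congr_hom (T.unit_naturality k) j
  have h₃ : T.unit _ ((T.coerce b).app B (T.unit B y)) =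
      (T.act (𝟙_ M)).map ((T.coerce b).app B) (T.unit ((T.act (𝟙_ M)).obj B) (T.unit B y)) :=
    ConcreteCategory.congr_hom (T.unit_naturality ((T.coerce b).app B)) (T.unit B y)
  have h₄ := (T.coerce a).naturality_apply ((T.coerce b).app B)
    (T.unit ((T.act (𝟙_ M)).obj B) (T.unit B y))
  have h₅ : T.mult m₁ m₂ B ((T.act m₁).map ((T.coerce b).app B)
      ((T.coerce a).app _ (T.unit ((T.act (𝟙_ M)).obj B) (T.unit B y)))) =
      (T.coerce (a ⊗ₘ b)).app B (T.mult _ _ B (T.unit ((T.act (𝟙_ M)).obj B) (T.unit B y))) :=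
    ConcreteCategory.congr_hom (T.mult_coerce a b B) (T.unit ((T.act (𝟙_ M)).obj B) (T.unit B y))
  have h₆ : (T.coerce (λ_ (𝟙_ M)).hom).app B (T.mult _ _ B (T.unit ((T.act (𝟙_ M)).obj B) (T.unit B y))) =
      T.unit B y := ConcreteCategory.congr_hom (T.unit_mult (𝟙_ M) B) (T.unit B y)
  rw [← h₁, ← h₂, hk, h₃, h₄, h₅]
  conv_rhs => rw [← h₆]
  have h₇ : (a ⊗ₘ b) = (λ_ (𝟙_ M)).hom ≫ (λ_ (𝟙_ M)).inv ≫ (a ⊗ₘ b) := by simp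
  conv_lhs => rw [h₇, T.coerce_comp]
  rfl

/-- The functor from the category of arities: it sends the `i`-th projection to `η(i)`. -/
def lawvereJ (T : GMnd M) : IdObjFunctor (arityCat M) (lawvereCat T) where
  map n n' :=
    { app := fun m => ↾fun φ => ↾fun i => var T (copowEquiv (copow M n) m φ i.down)
      naturality := fun m m' w => by
        refine ConcreteCategory.hom_ext _ _ fun φ => ?_
        refine lawvereCat.ext (T := T) (n := n) (n' := n') (m := m') fun i => ?_
        change var T (copowEquiv (copow M n) m' _ i.down) = (T.coerce w).app _ (var T _)
        rw [← var_map]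
        congr 1
        change (copow M n).map _ ((copow M n).map (𝟙_ M ◁ w) (rightHom.ev φ _ _)) =
          (copow M n).map _ ((copow M n).map _ (rightHom.ev φ _ _))
        simp only [← Functor.map_comp_apply]
        simp }
  map_one n := by
    refine lawvereCat.ext fun i => ?_
    change (T.coerce ((𝟙 _ ≫ (ρ_ (𝟙_ M)).inv) ≫ (λ_ (𝟙_ M)).hom)).app _ (T.unit _ ⟨i.down⟩) = T.unit _ i
    rw [unitors_equal, Category.id_comp, Iso.inv_hom_id, T.coerce_id]
    rfl
  map_comp {X Y Z m₁ m₂} g f := by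
    refine lawvereCat.ext fun i => ?_
    let x := copowEquiv (copow M Y) m₁ g i.down
    let y := copowEquiv (copow M X) m₂ f x.1
    change var T (copowEquiv (copow M X) (m₁ ⊗ m₂) ((arityCat M).comp g f) i.down) =
      T.mult m₁ m₂ _ ((T.act m₁).map (↾fun j : ULift (Fin Y) =>
        var T (copowEquiv (copow M X) m₂ f j.down)) (var T x))
    rw [copowEquiv_comp]
    change (T.coerce ((λ_ (𝟙_ M)).inv ≫ (x.2 ⊗ₘ y.2))).app _ (T.unit (ULift.{u} (Fin X)) ⟨y.1⟩) =
      T.mult m₁ m₂ _ ((T.act m₁).map _ ((T.coerce x.2).app _ (T.unit (ULift.{u} (Fin Y)) ⟨x.1⟩)))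
    exact (GMnd.mult_unit_unit T x.2 y.2 (↾fun j : ULift.{u} (Fin Y) =>
      var T (copowEquiv (copow M X) m₂ f j.down)) ⟨x.1⟩ ⟨y.1⟩ rfl).symm

lemma lawvereJ_arityMap (T : GMnd M) {n n' : ℕ} (σ : Fin n → Fin n') :
    ((lawvereJ T).map n' n).app (𝟙_ M) (arityMap σ) =
      (↾fun i : ULift (Fin n) => ULift.up (σ i.down)) ≫ T.unit (ULift.{u} (Fin n')) := by
  refine lawvereCat.ext fun i => ?_
  have h := (copowEquiv (copow M n') (𝟙_ M)).apply_symm_apply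
    (fun i => ((σ i, 𝟙 _) : Fin n' × (𝟙_ M ⟶ 𝟙_ M)))
  refine (congrArg (fun a => var T (a i.down)) h).trans ?_
  change (T.coerce (𝟙 _)).app _ _ = _
  rw [T.coerce_id]
  rfl

lemma lawvereCat_post_arityMap (T : GMnd M) {n n' k : ℕ} (σ : Fin n → Fin n') {m : M}
    (f : ((lawvereCat T).Hom k n').obj m) :
    (lawvereCat T).post (((lawvereJ T).map n' n).app (𝟙_ M) (arityMap σ)) f =
      (↾fun i : ULift (Fin n) => ULift.up (σ i.down)) ≫
        lawvereCat.toMap f := by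
  rw [lawvereJ_arityMap]
  have := (kleisliOp T).one_comp (X := ULift.{u} (Fin k)) (Y := ULift.{u} (Fin n')) f
  exact congrArg (fun g => (↾fun i : ULift (Fin n) => ULift.up (σ i.down)) ≫ g) this

lemma lawvereJ_standard (T : GMnd M) (n c : ℕ) :
    IsCotensor (lawvereCat T) (copow M n) c (n * c)
      (arityUnit M n c ≫ (lawvereJ T).map (n * c) c) := by
  rw [isCotensor_iff]
  intro k m
  let Z := (T.act m).obj (ULift.{u} (Fin k))
  let e₁ (a : ℕ) : (ULift.{u} (Fin a) ⟶ Z) ≃ (Fin a → Z) :=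
    TypeCat.homEquiv.trans (Equiv.ulift.arrowCongr (Equiv.refl _))
  let e₃ : (Fin (n * c) → Z) ≃ (Fin n → Fin c → Z) :=
    (finProdFinEquiv.symm.arrowCongr (Equiv.refl _)).trans (Equiv.curry _ _ _)
  have : (fun (f : ((lawvereCat T).Hom k (n * c)).obj m) (i : Fin n) =>
      (lawvereCat T).post (proj (A := lawvereCat T)
        (arityUnit M n c ≫ (lawvereJ T).map (n * c) c) i) f) =
      ((e₁ (n * c)).trans (e₃.trans (Equiv.piCongrRight fun _ => (e₁ c).symm))) := by
    funext f i
    have h : proj (A := lawvereCat T) (arityUnit M n c ≫ (lawvereJ T).map (n * c) c) i =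
        ((lawvereJ T).map (n * c) c).app (𝟙_ M) (arityMap fun j => finProdFinEquiv (i, j)) :=
      congrArg (((lawvereJ T).map (n * c) c).app (𝟙_ M))
        (proj_copowHom (A := arityCat M) (fun i => arityMap fun j => finProdFinEquiv (i, j)) i)
    rw [h, lawvereCat_post_arityMap]
    rfl
  rw [this]
  exact Equiv.bijective _

/-- The graded Lawvere theory `L_T` of a finitary graded monad `T`. -/
def lawvereObj (T : GMnd M) : GLaw M where
  cat := lawvereCat T
  hasCotensors n c := ⟨n * c, _, lawvereJ_standard T n c⟩
  J := lawvereJ T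
  preserves n c _ _ h :=
    preserves_of_one (lawvereJ T).toEnrFunctor (arityUnit_isCotensor n c) h
      (lawvereJ_standard T n c)

/-- The morphism `L_α`, given on `Set(n', m * n)` by composition with the component of `α`. -/
def lawvereMap {T T' : GMnd M} (α : T ⟶ T') : lawvereObj T ⟶ lawvereObj T' where
  functor :=
    { map := fun n n' =>
        { app := fun m => ↾fun (f : ULift.{u} (Fin n') ⟶ (T.act m).obj (ULift.{u} (Fin n))) =>
            f ≫ (GMnd.component α m).app _
          naturality := fun m m' w => by
            refine ConcreteCategory.hom_ext _ _ fun f => ?_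
            have := congrArg (fun k => NatTrans.app k (ULift.{u} (Fin n)))
              (GMnd.component_coerce α w)
            exact congrArg (fun k => lawvereCat.toMap f ≫ k) this }
      map_one := fun n => GMnd.component_unit α _
      map_comp := fun {X Y Z m₁ m₂} g f => by
        revert f g
        change ∀ (g : ULift.{u} (Fin Z) ⟶ (T.act m₁).obj (ULift.{u} (Fin Y)))
          (f : ULift.{u} (Fin Y) ⟶ (T.act m₂).obj (ULift.{u} (Fin X))),
          (g ≫ (T.act m₁).map f ≫ T.mult m₁ m₂ _) ≫ (GMnd.component α (m₁ ⊗ m₂)).app _ =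
          (g ≫ (GMnd.component α m₁).app _) ≫ (T'.act m₁).map (f ≫ (GMnd.component α m₂).app _) ≫
            T'.mult m₁ m₂ _
        intro g f
        have h := (GMnd.component α m₁).naturality f
        simp only [Functor.map_comp, Category.assoc]
        rw [GMnd.component_mult, reassoc_of% h] }
  comm := by
    ext1
    funext n n'
    ext m φ
    refine lawvereCat.ext fun i => ?_
    let x := copowEquiv (copow M n) m φ i.down
    change (GMnd.component α m).app _ ((T.coerce x.2).app _ (T.unit (ULift.{u} (Fin n)) ⟨x.1⟩)) =
      (T'.coerce x.2).app _ (T'.unit (ULift.{u} (Fin n)) ⟨x.1⟩)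
    rw [← GMnd.component_unit α]
    exact ConcreteCategory.congr_hom (congrArg (fun k => NatTrans.app k (ULift.{u} (Fin n)))
      (GMnd.component_coerce α x.2)) (T.unit (ULift.{u} (Fin n)) ⟨x.1⟩)

/-- The functor `L₍₋₎` from finitary graded monads to graded Lawvere theories. -/
def lawvereFunctor (M : Type u) [SmallCategory M] [MonoidalCategory M] : GMnd M ⥤ GLaw M where
  obj := lawvereObj
  map := lawvereMap
  map_id T := by
    apply GLaw.Hom.ext; ext1; funext n n'; ext m f
    rfl
  map_comp α β := by
    apply GLaw.Hom.ext; ext1; funext n n'; ext m f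
    rfl

end LawvereOfMonad

section TermMonad

/-- The full subcategory `ℵ₀` of `Set` on the natural numbers. -/
structure Aleph0 : Type where
  card : ℕ

instance : Category.{0} Aleph0 where
  Hom n n' := Fin n.card → Fin n'.card
  id _ := id
  comp σ τ := τ ∘ σ

/-- The functor `L(-, 1) m : ℵ₀ ⥤ Set`; a function `σ` acts by composition with its image under
`Set(n, n') → N(n', n) I → L(n', n) I`. -/
def termFunctor (L : GLaw M) (m : M) : Aleph0 ⥤ Type u where
  obj n := (L.cat.Hom n.card 1).obj m
  map {n n'} σ := ↾fun f => L.cat.pre f ((L.J.map n'.card n.card).app (𝟙_ M) (arityMap σ))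
  map_id n := by
    refine ConcreteCategory.hom_ext _ _ fun f => ?_
    change L.cat.pre f ((L.J.map n.card n.card).app (𝟙_ M) (arityMap _root_.id)) = f
    rw [arityMap_id, L.J.map_one]
    exact L.cat.comp_one f
  map_comp {n n' n''} σ τ := by
    refine ConcreteCategory.hom_ext _ _ fun f => ?_
    change L.cat.pre f ((L.J.map n''.card n.card).app (𝟙_ M) (arityMap (τ ∘ σ))) =
      L.cat.pre (L.cat.pre f _) _
    rw [L.cat.pre_pre, arityMap_comp]
    exact congrArg (L.cat.pre f) (L.J.toEnrFunctor.map_post _ _)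

/-- The bifunctor `(n', n) ↦ L(n, 1) m × X^n'`. -/
def termBifunctor (L : GLaw M) (m : M) (X : Type u) : Aleph0ᵒᵖ ⥤ Aleph0 ⥤ Type u where
  obj n' :=
    { obj := fun n => (termFunctor L m).obj n × (Fin n'.unop.card → X)
      map := fun σ => ↾fun y => ((termFunctor L m).map σ y.1, y.2) }
  map σ := { app := fun n => ↾fun y => (y.1, y.2 ∘ σ.unop) }

/-- The `i`-th projection `π_i ∈ L(n, 1) I`. -/
def GLaw.π (L : GLaw M) {n : ℕ} (i : Fin n) : (L.cat.Hom n 1).obj (𝟙_ M) :=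
  (L.J.map n 1).app (𝟙_ M) (arityMap fun _ => i)

/-- The data exhibiting `T` as the graded monad of terms of `L`: `κ` exhibits `m * X` as the coend
`∫^n L(n, 1) m × X^n`, functorially in `m` and `X`; the unit sends `x` to the variable `x`, and the
multiplication is substitution of terms. (By dinaturality every finite family of elements of
`m₂ * X` can be written as `i ↦ κ (π_i ∘ g, x)` for a single `g ∈ L(k, n) m₂` and `x ∈ X^k`.) -/
structure TermMonad (L : GLaw M) (T : GMnd M) where
  κ : ∀ (m : M) (X : Type u) (n : ℕ), (L.cat.Hom n 1).obj m × (Fin n → X) → (T.act m).obj X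
  dinatural : ∀ (m : M) (X : Type u) ⦃n n' : Aleph0⦄ (σ : n ⟶ n'),
    ((termBifunctor L m X).map σ.op).app n ≫ ↾(κ m X n.card) =
      ((termBifunctor L m X).obj (op n')).map σ ≫ ↾(κ m X n'.card)
  isCoend : ∀ (m : M) (X : Type u), Nonempty (IsColimit
    (Cowedge.mk (F := termBifunctor L m X) ((T.act m).obj X) (fun n => ↾(κ m X n.card))
      (dinatural m X)))
  coerce_κ : ∀ {m m' : M} (w : m ⟶ m') (X : Type u) (n : ℕ) (f : (L.cat.Hom n 1).obj m)
    (x : Fin n → X), (T.coerce w).app X (κ m X n (f, x)) = κ m' X n ((L.cat.Hom n 1).map w f, x)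
  map_κ : ∀ (m : M) {X Y : Type u} (h : X ⟶ Y) (n : ℕ) (f : (L.cat.Hom n 1).obj m)
    (x : Fin n → X), (T.act m).map h (κ m X n (f, x)) = κ m Y n (f, fun i => h (x i))
  unit_κ : ∀ (X : Type u) (x : X), T.unit X x = κ (𝟙_ M) X 1 (L.cat.one 1, fun _ => x)
  mult_κ : ∀ (m₁ m₂ : M) (X : Type u) (n k : ℕ) (f : (L.cat.Hom n 1).obj m₁)
    (g : (L.cat.Hom k n).obj m₂) (x : Fin k → X),
    T.mult m₁ m₂ X (κ m₁ ((T.act m₂).obj X) n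
        (f, fun i => κ m₂ X k (L.cat.post (L.π i) g, x))) =
      κ (m₁ ⊗ m₂) X k (L.cat.comp f g, x)

end TermMonad

end EnrichedCategories

end GradedTheory

/-! A finitary endofunctor `F` of sets is determined by its values on finite sets. Every set is the
filtered union of its finite subsets, so each element of `F X` is `elt F f x` with `f ∈ F n` and `x
∈ X^n` (`exists_elt`), and two such elements agree only if they already agree after renaming their
variables into a common finite set (`elt_eq_elt`). Hence maps on finite sets that respect renaming
extend uniquely to a natural transformation (`extendHom`, `natTrans_ext_of_finitary`).

Full faithfulness: a morphism `n → 1` of grade `m` in `L_T` is an element of `m * n`, and a morphism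
into `n'` is a family of `n'` of them, read off by the projections. A morphism of theories commutes
with `J`, hence with projections and renamings, so it amounts to maps on the sets `m * n` natural in
`n`. Preservation of identities and composites is then compatibility with unit and multiplication on
finite sets, and finitarity carries this to all sets.

Essential surjectivity: the coend of terms is built as an explicit quotient (`Aleph0.Ext`). By the
cotensor property (`GLaw.π_bijective`) a finite family of terms, once written over common variables,
is a single morphism `k → n`, so substitution is composition in `L`; `GLaw.term_comp_congr` shows
that the choice of presentation does not matter. The monad laws follow from the category laws of
`L`. Terms in `n` variables are again the operations `n → 1` (`GLaw.term_up_bijective`), so `L` is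
isomorphic to the theory of its term monad.

The coend formula is not tied to this construction: whenever a morphism `L ⟶ L_T` is bijective on
operations, `T` is a graded monad of terms of `L` (`termMonadOfBijective`). Applied to the inverse
of the counit, this describes the inverse of the equivalence. -/

namespace GradedTheory

/-! ### Finite families and filtered colimits of sets. -/

section FinitaryFunctors

/-- Enumerate the range of the family. Injectivity of `e` is what later allows two renamings to be
compared by their effect on elements of `X`. -/
lemma exists_injective_factor {ι X : Type*} [Finite ι] (z : ι → X) :
    ∃ (k : ℕ) (e : Fin k → X) (σ : ι → Fin k), Function.Injective e ∧ ∀ i, e (σ i) = z i := by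
  have : Finite (Set.range z) := Set.finite_range z
  let φ := Finite.equivFin (Set.range z)
  exact ⟨_, fun j => (φ.symm j).1, fun i => φ ⟨z i, i, rfl⟩,
    Subtype.val_injective.comp φ.symm.injective,
    fun i => congrArg Subtype.val (φ.symm_apply_apply _)⟩

/-- A finite family of elements of the colimit of a filtered diagram lifts to one stage. -/
lemma exists_lift_of_isColimit {J : Type u} [SmallCategory J] [IsFiltered J]
    {D : J ⥤ Type u} {c : Cocone D} (hc : IsColimit c) {n : ℕ} (x : Fin n → c.pt) (j₀ : J) :
    ∃ (j : J) (_ : j₀ ⟶ j) (z : Fin n → D.obj j), ∀ i, c.ι.app j (z i) = x i := by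
  induction n with
  | zero => exact ⟨j₀, 𝟙 _, Fin.elim0, fun i => i.elim0⟩
  | succ n ih =>
    obtain ⟨j, w, z, hz⟩ := ih fun i => x i.succ
    obtain ⟨j', a, ha⟩ := Types.jointly_surjective_of_isColimit hc (x 0)
    refine ⟨IsFiltered.max j j', w ≫ IsFiltered.leftToMax _ _,
      Fin.cons (D.map (IsFiltered.rightToMax _ _) a) fun i => D.map (IsFiltered.leftToMax _ _) (z i),
      fun i => ?_⟩
    refine Fin.cases ?_ (fun i => ?_) i
    · rw [Fin.cons_zero, ← ha]
      exact ConcreteCategory.congr_hom (c.w (IsFiltered.rightToMax j j')) a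
    · rw [Fin.cons_succ, ← hz]
      exact ConcreteCategory.congr_hom (c.w (IsFiltered.leftToMax j j')) (z i)

/-- Two finite families at one stage that agree in the colimit agree at a later stage. -/
lemma exists_map_eq_of_isColimit {J : Type u} [SmallCategory J] [IsFiltered J]
    {D : J ⥤ Type u} {c : Cocone D} (hc : IsColimit c) {n : ℕ} {j : J} (x y : Fin n → D.obj j)
    (h : ∀ i, c.ι.app j (x i) = c.ι.app j (y i)) :
    ∃ (k : J) (w : j ⟶ k), ∀ i, D.map w (x i) = D.map w (y i) := by
  induction n with
  | zero => exact ⟨j, 𝟙 _, fun i => i.elim0⟩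
  | succ n ih =>
    obtain ⟨k, w, hw⟩ := ih (fun i => x i.succ) (fun i => y i.succ) fun i => h _
    have h₀ : c.ι.app k (D.map w (x 0)) = c.ι.app k (D.map w (y 0)) :=
      (ConcreteCategory.congr_hom (c.w w) (x 0)).trans
        ((h 0).trans (ConcreteCategory.congr_hom (c.w w) (y 0)).symm)
    obtain ⟨l, w', hw'⟩ := (Types.FilteredColimit.isColimit_eq_iff' hc _ _).1 h₀
    refine ⟨l, w ≫ w', fun i => ?_⟩
    rw [Functor.map_comp_apply, Functor.map_comp_apply]
    refine Fin.cases hw' (fun i => ?_) i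
    rw [hw]

/-! ### The coend of terms as an explicit quotient. -/

namespace Aleph0

/-- The action of a function on the values of a functor on `ℵ₀`. -/
def ren (G : Aleph0 ⥤ Type u) {n n' : ℕ} (σ : Fin n → Fin n') (f : G.obj ⟨n⟩) : G.obj ⟨n'⟩ :=
  G.map (X := ⟨n⟩) (Y := ⟨n'⟩) σ f

lemma ren_ren (G : Aleph0 ⥤ Type u) {n n' n'' : ℕ} (σ : Fin n → Fin n') (τ : Fin n' → Fin n'')
    (f : G.obj ⟨n⟩) : ren G τ (ren G σ f) = ren G (fun i => τ (σ i)) f :=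
  (ConcreteCategory.congr_hom
    (G.map_comp (X := ⟨n⟩) (Y := ⟨n'⟩) (Z := ⟨n''⟩) σ τ) f).symm

lemma ren_app {G G' : Aleph0 ⥤ Type u} (α : G ⟶ G') {n n' : ℕ} (σ : Fin n → Fin n')
    (f : G.obj ⟨n⟩) : α.app ⟨n'⟩ (ren G σ f) = ren G' σ (α.app ⟨n⟩ f) :=
  α.naturality_apply (X := ⟨n⟩) (Y := ⟨n'⟩) σ f

/-- Two formal terms `(f, x)` and `(f', x')` are identified if they have a common injective
reparametrisation `e`. -/
def TermRel (G : Aleph0 ⥤ Type u) (X : Type u) (s t : Σ n : ℕ, G.obj ⟨n⟩ × (Fin n → X)) : Prop :=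
  ∃ (k : ℕ) (e : Fin k → X) (σ : Fin s.1 → Fin k) (τ : Fin t.1 → Fin k), Function.Injective e ∧
    (∀ i, e (σ i) = s.2.2 i) ∧ (∀ i, e (τ i) = t.2.2 i) ∧ ren G σ s.2.1 = ren G τ t.2.1

/-- For transitivity, enumerate the values of both witnesses `e` and `e'` by one injective `d`. The
tuple of the middle term is then renamed in two ways with the same composite with `d`, so the two
renamings coincide and the two equations can be chained. -/
lemma termRel_equivalence (G : Aleph0 ⥤ Type u) (X : Type u) : _root_.Equivalence (TermRel G X) where
  refl := fun s => by
    obtain ⟨k, e, σ, he, h⟩ := exists_injective_factor s.2.2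
    exact ⟨k, e, σ, σ, he, h, h, rfl⟩
  symm := fun ⟨k, e, σ, τ, he, h, h', h''⟩ => ⟨k, e, τ, σ, he, h', h, h''.symm⟩
  trans := fun {r s t} ⟨k, e, σ, τ, _, h₁, h₂, h₃⟩ ⟨k', e', σ', τ', _, h₁', h₂', h₃'⟩ => by
    obtain ⟨l, d, φ, hd, h⟩ := exists_injective_factor (Sum.elim e e')
    have hl (i) : d (φ (.inl i)) = e i := h (.inl i)
    have hr (i) : d (φ (.inr i)) = e' i := h (.inr i)
    refine ⟨l, d, fun i => φ (.inl (σ i)), fun i => φ (.inr (τ' i)), hd, fun i => ?_, fun i => ?_, ?_⟩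
    · rw [hl, h₁]
    · rw [hr, h₂']
    · have : (fun i => φ (.inl (τ i))) = fun i => φ (.inr (σ' i)) :=
        funext fun i => hd (by rw [hl, hr, h₂, h₁'])
      rw [← ren_ren G σ (fun i => φ (.inl i)), h₃, ren_ren, this,
        ← ren_ren G σ' (fun i => φ (.inr i)), h₃', ren_ren]

/-- The coend `∫^n G(n) × X^n`. -/
def Ext (G : Aleph0 ⥤ Type u) (X : Type u) : Type u :=
  Quotient ⟨TermRel G X, termRel_equivalence G X⟩

/-- The class of `(f, x)` in `∫^n G(n) × X^n`. -/
def Ext.mk (G : Aleph0 ⥤ Type u) {X : Type u} {n : ℕ} (f : G.obj ⟨n⟩) (x : Fin n → X) : Ext G X :=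
  Quotient.mk _ ⟨n, f, x⟩

namespace Ext

variable {G : Aleph0 ⥤ Type u} {X Y : Type u}

lemma exists_rep (y : Ext G X) : ∃ (n : ℕ) (f : G.obj ⟨n⟩) (x : Fin n → X), mk G f x = y := by
  obtain ⟨⟨n, f, x⟩, rfl⟩ := Quotient.exists_rep y
  exact ⟨n, f, x, rfl⟩

lemma mk_eq_mk_iff {n n' : ℕ} {f : G.obj ⟨n⟩} {x : Fin n → X} {f' : G.obj ⟨n'⟩} {x' : Fin n' → X} :
    mk G f x = mk G f' x' ↔ ∃ (k : ℕ) (e : Fin k → X) (σ : Fin n → Fin k) (τ : Fin n' → Fin k),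
      Function.Injective e ∧ (∀ i, e (σ i) = x i) ∧ (∀ i, e (τ i) = x' i) ∧
        ren G σ f = ren G τ f' :=
  Quotient.eq

/-- This is the dinaturality of the coend. An injective factorization of `x` serves as the common
reparametrisation. -/
lemma mk_ren {n n' : ℕ} (σ : Fin n → Fin n') (f : G.obj ⟨n⟩) (x : Fin n' → X) :
    mk G (ren G σ f) x = mk G f fun i => x (σ i) := by
  obtain ⟨k, e, τ, he, h⟩ := exists_injective_factor x
  exact mk_eq_mk_iff.2 ⟨k, e, τ, fun i => τ (σ i), he, h, fun i => h _, ren_ren _ _ _ _⟩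

/-- A map out of the coend. -/
def desc {Z : Type*} (s : ∀ n : ℕ, G.obj ⟨n⟩ → (Fin n → X) → Z)
    (hs : ∀ {n n' : ℕ} (σ : Fin n → Fin n') (f : G.obj ⟨n⟩) (x : Fin n' → X),
      s n' (ren G σ f) x = s n f fun i => x (σ i)) : Ext G X → Z :=
  Quotient.lift (fun t => s t.1 t.2.1 t.2.2) (by
    rintro ⟨n, f, x⟩ ⟨n', f', x'⟩ ⟨k, e, σ, τ, -, h₁, h₂, h⟩
    have h₁ : (fun i => e (σ i)) = x := funext h₁
    have h₂ : (fun i => e (τ i)) = x' := funext h₂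
    -- Both values are those of the common renamed term with arguments `e`.
    have h := (hs σ f e).symm.trans ((congrArg (fun a => s k a e) h).trans (hs τ f' e))
    rwa [h₁, h₂] at h)

/-- The functor `X ↦ ∫^n G(n) × X^n`. -/
def functor (G : Aleph0 ⥤ Type u) : Type u ⥤ Type u where
  obj X := Ext G X
  map h := ↾desc (fun _ f x => mk G f fun i => h (x i)) fun σ f x => mk_ren σ f _
  map_id X := ConcreteCategory.hom_ext _ _ fun y => by
    obtain ⟨n, f, x, rfl⟩ := exists_rep y; rfl
  map_comp _ _ := ConcreteCategory.hom_ext _ _ fun y => by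
    obtain ⟨n, f, x, rfl⟩ := exists_rep y; rfl

/-- The natural transformation induced by a natural transformation of functors on `ℵ₀`. -/
def functorMap {G G' : Aleph0 ⥤ Type u} (α : G ⟶ G') : functor G ⟶ functor G' where
  app X := ↾desc (fun n f x => mk G' (α.app ⟨n⟩ f) x) fun σ f x =>
    (congrArg (fun a => mk G' a x) (ren_app α σ f)).trans (mk_ren σ _ x)
  naturality X Y h := ConcreteCategory.hom_ext _ _ fun y => by
    obtain ⟨n, f, x, rfl⟩ := exists_rep y; rfl

/-- A term involves finitely many elements of `X`, and so does a proof that two terms are equal.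
Both therefore live at one stage of a filtered diagram. -/
lemma finitary_functor (G : Aleph0 ⥤ Type u) : finitary (functor G) := by
  refine ⟨fun J _ _ => ⟨fun {D} => ⟨fun {c} hc => ⟨?_⟩⟩⟩⟩
  refine Types.FilteredColimit.isColimitOf' _ _ (fun y => ?_) (fun j y y' h => ?_)
  · obtain ⟨n, f, x, rfl⟩ := exists_rep y
    obtain ⟨j, -, z, hz⟩ := exists_lift_of_isColimit hc x (Classical.choice IsFiltered.nonempty)
    exact ⟨j, mk G f z, congrArg (mk G f) (funext fun i => (hz i).symm)⟩
  · obtain ⟨n, f, x, rfl⟩ := exists_rep y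
    obtain ⟨n', f', x', rfl⟩ := exists_rep y'
    obtain ⟨k, e, σ, τ, -, h₁, h₂, h₃⟩ := mk_eq_mk_iff.1 h
    obtain ⟨j', w, z, hz⟩ := exists_lift_of_isColimit hc e j
    have hw (a : D.obj j) : c.ι.app j' (D.map w a) = c.ι.app j a :=
      ConcreteCategory.congr_hom (c.w w) a
    -- The witness `e` has been lifted to `z`, but `x` and `z ∘ σ` agree only in the colimit. Moving
    -- to `l` makes them equal; moving on to `l'` does the same for `x'` and `z ∘ τ`.
    obtain ⟨l, v, hv⟩ := exists_map_eq_of_isColimit hc (fun i => D.map w (x i)) (fun i => z (σ i))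
      fun i => by rw [hw, hz]; exact (h₁ i).symm
    obtain ⟨l', v', hv'⟩ := exists_map_eq_of_isColimit hc (fun i => D.map v (D.map w (x' i)))
      (fun i => D.map v (z (τ i))) fun i => by
        have hv₀ (a : D.obj j') : c.ι.app l (D.map v a) = c.ι.app j' a :=
          ConcreteCategory.congr_hom (c.w v) a
        rw [hv₀, hv₀, hw, hz]; exact (h₂ i).symm
    refine ⟨l', w ≫ v ≫ v', ?_⟩
    have e₁ : (fun i => D.map (w ≫ v ≫ v') (x i)) = fun i => D.map v' (D.map v (z (σ i))) := by
      funext i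
      rw [Functor.map_comp_apply, Functor.map_comp_apply, hv]
    have e₂ : (fun i => D.map (w ≫ v ≫ v') (x' i)) = fun i => D.map v' (D.map v (z (τ i))) := by
      funext i
      rw [Functor.map_comp_apply, Functor.map_comp_apply, hv']
    change mk G f (fun i => D.map (w ≫ v ≫ v') (x i)) = mk G f' fun i => D.map (w ≫ v ≫ v') (x' i)
    rw [e₁, e₂, ← mk_ren σ f (fun i => D.map v' (D.map v (z i))), h₃, mk_ren]

end Ext

end Aleph0

/-! ### Finitary functors are generated by finite sets. -/

/-- The element of `F X` named by `f ∈ F n` and `x ∈ X^n`. -/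
def elt (F : Type u ⥤ Type u) {n : ℕ} (f : F.obj (ULift.{u} (Fin n))) {X : Type u} (x : Fin n → X) :
    F.obj X :=
  F.map (↾fun i : ULift.{u} (Fin n) => x i.down) f

section Elt

variable {F : Type u ⥤ Type u} {X Y : Type u}

lemma map_elt (h : X ⟶ Y) {n : ℕ} (f : F.obj (ULift.{u} (Fin n))) (x : Fin n → X) :
    F.map h (elt F f x) = elt F f fun i => h (x i) :=
  (Functor.map_comp_apply F _ _ _).symm

lemma elt_elt {n k : ℕ} (f : F.obj (ULift.{u} (Fin n))) (σ : Fin n → Fin k) (x : Fin k → X) :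
    elt F (elt F f fun i => ULift.up (σ i)) x = elt F f fun i => x (σ i) :=
  map_elt _ _ _

lemma elt_up {n : ℕ} (f : F.obj (ULift.{u} (Fin n))) : elt F f ULift.up = f :=
  ConcreteCategory.congr_hom (F.map_id _) f

lemma app_elt {F' : Type u ⥤ Type u} (α : F ⟶ F') {n : ℕ} (f : F.obj (ULift.{u} (Fin n)))
    (x : Fin n → X) : α.app X (elt F f x) = elt F' (α.app _ f) x :=
  α.naturality_apply _ f

/-- The cocone on the diagram of finite subsets of `X`. -/
def finsetDiagram (X : Type u) : Finset X ⥤ Type u where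
  obj S := {x : X // x ∈ S}
  map w := ↾fun x => ⟨x.1, leOfHom w x.2⟩

/-- A set is the union of its finite subsets. -/
def finsetCocone (X : Type u) : Cocone (finsetDiagram X) where
  pt := X
  ι := { app := fun S => ↾fun x => x.1 }

lemma finsetCocone_isColimit (X : Type u) : Nonempty (IsColimit (finsetCocone X)) := by
  classical
  refine ⟨Types.FilteredColimit.isColimitOf' _ _ (fun x => ?_) fun S x y h => ?_⟩
  · exact ⟨{x}, ⟨x, Finset.mem_singleton_self x⟩, rfl⟩
  · exact ⟨S, 𝟙 S, congrArg _ (Subtype.ext h)⟩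

/-- `F` preserves the union of the finite subsets of `X`, so `y` comes from `F S` with `S` finite;
numbering `S` gives `f` and `x`. -/
lemma exists_elt (hF : finitary F) (y : F.obj X) :
    ∃ (n : ℕ) (f : F.obj (ULift.{u} (Fin n))) (x : Fin n → X), elt F f x = y := by
  classical
  have : PreservesFilteredColimits F := hF
  obtain ⟨hc⟩ := finsetCocone_isColimit X
  obtain ⟨S, a, rfl⟩ := Types.jointly_surjective_of_isColimit (isColimitOfPreserves F hc) y
  let φ : ULift.{u} (Fin _) ≃ S := Equiv.ulift.trans S.equivFin.symm
  refine ⟨_, F.map (↾φ.symm) a, fun i => (S.equivFin.symm i).1, ?_⟩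
  have : (↾φ.symm : (S : Type u) ⟶ _) ≫ ↾(fun i => (S.equivFin.symm i.down).1) =
      (finsetCocone X).ι.app S := by
    ext x
    exact congrArg Subtype.val (φ.apply_symm_apply x)
  refine (Functor.map_comp_apply F _ _ _).symm.trans ?_
  exact congrArg (fun h => F.map h a) this

lemma elt_eq_elt (hF : finitary F) {n n' : ℕ} {f : F.obj (ULift.{u} (Fin n))} {x : Fin n → X}
    {f' : F.obj (ULift.{u} (Fin n'))} {x' : Fin n' → X} (h : elt F f x = elt F f' x') :
    ∃ (k : ℕ) (e : Fin k → X) (σ : Fin n → Fin k) (τ : Fin n' → Fin k),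
      (∀ i, e (σ i) = x i) ∧ (∀ i, e (τ i) = x' i) ∧
        elt F f (fun i => ULift.up (σ i)) = elt F f' (fun i => ULift.up (τ i)) := by
  classical
  have : PreservesFilteredColimits F := hF
  obtain ⟨hc⟩ := finsetCocone_isColimit X
  -- A finite subset containing both families, so that both elements come from `F S`; their images
  -- in `F X` agree, hence already their images in some `F S'`.
  let S : Finset X := Finset.univ.image x ∪ Finset.univ.image x'
  have hx (i) : x i ∈ S :=
    Finset.mem_union_left _ (Finset.mem_image_of_mem x (Finset.mem_univ i))
  have hx' (i) : x' i ∈ S :=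
    Finset.mem_union_right _ (Finset.mem_image_of_mem x' (Finset.mem_univ i))
  let a : F.obj S := elt F f fun i => ⟨x i, hx i⟩
  let a' : F.obj S := elt F f' fun i => ⟨x' i, hx' i⟩
  have ha' : F.map ((finsetCocone X).ι.app S) a' = elt F f' x' := map_elt _ _ _
  have haa : F.map ((finsetCocone X).ι.app S) a = F.map ((finsetCocone X).ι.app S) a' :=
    (map_elt _ _ _).trans (h.trans ha'.symm)
  obtain ⟨S', w, hw⟩ :=
    (Types.FilteredColimit.isColimit_eq_iff' (isColimitOfPreserves F hc) a a').1 haa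
  have hw : F.map ((finsetDiagram X).map w) a = F.map ((finsetDiagram X).map w) a' := hw
  -- Numbering `S'` turns `x` and `x'` into the renamings `σ` and `τ`, and the inverse numbering
  -- into `e`.
  let φ : S' ≃ ULift.{u} (Fin _) := S'.equivFin.trans Equiv.ulift.symm
  have hw' := congrArg (fun b => F.map (↾φ) b) hw
  simp only [a, a'] at hw'
  erw [map_elt, map_elt, map_elt, map_elt] at hw'
  refine ⟨_, fun i => (S'.equivFin.symm i).1, fun i => S'.equivFin ⟨x i, leOfHom w (hx i)⟩,
    fun i => S'.equivFin ⟨x' i, leOfHom w (hx' i)⟩, fun i => ?_, fun i => ?_, hw'⟩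
  · simp
  · simp

end Elt

end FinitaryFunctors

/-! ### Graded monads and their morphisms from elementary data. -/

section GradedMonadConstructors

attribute [local instance] endofunctorMonoidalCategory

variable {M : Type u} [SmallCategory M] [MonoidalCategory M]

namespace GMnd

/-- A morphism of graded monads from its components. -/
def homMk {T T' : GMnd M} (c : ∀ m, T.act m ⟶ T'.act m)
    (hc : ∀ {m m' : M} (w : m ⟶ m'), T.coerce w ≫ c m' = c m ≫ T'.coerce w)
    (hu : ∀ X, T.unit X ≫ (c (𝟙_ M)).app X = T'.unit X)
    (hm : ∀ (m₁ m₂ : M) (X : Type u), T.mult m₁ m₂ X ≫ (c (m₁ ⊗ m₂)).app X =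
      (c m₁).app _ ≫ (T'.act m₁).map ((c m₂).app X) ≫ T'.mult m₁ m₂ X) : T ⟶ T' where
  hom :=
    { app := fun m => Quiver.Hom.mop
        (ObjectProperty.homMk (X := (T.toFunctor.obj m).unmop) (Y := (T'.toFunctor.obj m).unmop)
          (c m))
      naturality := fun _ _ w => MonoidalOpposite.hom_ext (InducedCategory.hom_ext (hc w)) }
  isMonoidal :=
    { unit := MonoidalOpposite.hom_ext (InducedCategory.hom_ext
        (NatTrans.ext (funext fun X => hu X)))
      tensor := fun m₁ m₂ => MonoidalOpposite.hom_ext (InducedCategory.hom_ext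
        (NatTrans.ext (funext fun X => hm m₁ m₂ X))) }

lemma hom_ext {T T' : GMnd M} {α β : T ⟶ T'} (h : ∀ m, component α m = component β m) : α = β := by
  apply LaxMonoidalFunctor.hom_ext
  ext m : 2
  exact MonoidalOpposite.hom_ext (InducedCategory.hom_ext (h m))

lemma finitary_act (T : GMnd M) (m : M) : finitary (T.act m) :=
  (T.toFunctor.obj m).unmop.property

/-- A graded monad from its endofunctors, unit and multiplication. -/
def ofData (F : M ⥤ (Type u ⥤ Type u)) (hF : ∀ m, finitary (F.obj m)) (η : 𝟭 (Type u) ⟶ F.obj (𝟙_ M))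
    (μ : ∀ m₁ m₂ : M, F.obj m₂ ⋙ F.obj m₁ ⟶ F.obj (m₁ ⊗ m₂))
    (μ_natural : ∀ {m₁ m₁' m₂ m₂' : M} (w₁ : m₁ ⟶ m₁') (w₂ : m₂ ⟶ m₂') (X : Type u),
      (F.map w₁).app _ ≫ (F.obj m₁').map ((F.map w₂).app X) ≫ (μ m₁' m₂').app X =
        (μ m₁ m₂).app X ≫ (F.map (w₁ ⊗ₘ w₂)).app X)
    (assoc : ∀ (m₁ m₂ m₃ : M) (X : Type u),
      (μ m₁ m₂).app ((F.obj m₃).obj X) ≫ (μ (m₁ ⊗ m₂) m₃).app X ≫ (F.map (α_ m₁ m₂ m₃).hom).app X =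
        (F.obj m₁).map ((μ m₂ m₃).app X) ≫ (μ m₁ (m₂ ⊗ m₃)).app X)
    (left_unit : ∀ (m : M) (X : Type u),
      η.app ((F.obj m).obj X) ≫ (μ (𝟙_ M) m).app X ≫ (F.map (λ_ m).hom).app X = 𝟙 _)
    (right_unit : ∀ (m : M) (X : Type u),
      (F.obj m).map (η.app X) ≫ (μ m (𝟙_ M)).app X ≫ (F.map (ρ_ m).hom).app X = 𝟙 _) : GMnd M where
  obj m := MonoidalOpposite.mop ⟨F.obj m, hF m⟩
  map {m m'} w := Quiver.Hom.mop
    (ObjectProperty.homMk (P := finitary) (X := ⟨F.obj m, hF m⟩) (Y := ⟨F.obj m', hF m'⟩) (F.map w))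
  map_id m := MonoidalOpposite.hom_ext (InducedCategory.hom_ext (F.map_id m))
  map_comp w w' := MonoidalOpposite.hom_ext (InducedCategory.hom_ext (F.map_comp w w'))
  laxMonoidal :=
    { ε := Quiver.Hom.mop (X := (𝟙_ FinEnd.{u}).unmop) (ObjectProperty.homMk (P := finitary)
        (X := (𝟙_ FinEnd.{u}).unmop) (Y := ⟨F.obj (𝟙_ M), hF _⟩) η)
      μ := fun m₁ m₂ => Quiver.Hom.mop
        (ObjectProperty.homMk (P := finitary)
          (X := (⟨F.obj m₂, hF m₂⟩ : finitary.FullSubcategory) ⊗ ⟨F.obj m₁, hF m₁⟩)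
          (Y := ⟨F.obj (m₁ ⊗ m₂), hF _⟩) (μ m₁ m₂))
      μ_natural_left := fun {m₁ m₁'} w m₂ => MonoidalOpposite.hom_ext (InducedCategory.hom_ext
        (NatTrans.ext (funext fun X => by
          have h := μ_natural w (𝟙 m₂) X
          rw [F.map_id, NatTrans.id_app, (F.obj m₁').map_id, Category.id_comp, tensorHom_id] at h
          exact h)))
      μ_natural_right := fun {m₂ m₂'} m₁ w => MonoidalOpposite.hom_ext (InducedCategory.hom_ext
        (NatTrans.ext (funext fun X => by
          have h := μ_natural (𝟙 m₁) w X
          rw [F.map_id, NatTrans.id_app, Category.id_comp, id_tensorHom] at h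
          exact h)))
      associativity := fun m₁ m₂ m₃ => MonoidalOpposite.hom_ext (InducedCategory.hom_ext
        (NatTrans.ext (funext fun X => assoc m₁ m₂ m₃ X)))
      left_unitality := fun m => MonoidalOpposite.hom_ext (InducedCategory.hom_ext
        (NatTrans.ext (funext fun X => (left_unit m X).symm)))
      right_unitality := fun m => MonoidalOpposite.hom_ext (InducedCategory.hom_ext
        (NatTrans.ext (funext fun X => (right_unit m X).symm))) }

end GMnd

end GradedMonadConstructors

/-! ### Extension from finite sets, and full faithfulness. -/

section FullyFaithful

variable {M : Type u} [SmallCategory M] [MonoidalCategory M]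

/-- Well-definedness of the extension `elt F f x ↦ elt F' (a n f) x`: an equality is witnessed by a
common renaming, and `a` respects renamings. -/
lemma elt_eq_elt_of_natural {F F' : Type u ⥤ Type u} (hF : finitary F)
    (a : ∀ n : ℕ, F.obj (ULift.{u} (Fin n)) → F'.obj (ULift.{u} (Fin n)))
    (ha : ∀ {n k : ℕ} (f : F.obj (ULift.{u} (Fin n))) (σ : Fin n → Fin k),
      a k (elt F f fun i => ULift.up (σ i)) = elt F' (a n f) fun i => ULift.up (σ i))
    {X : Type u} {n n' : ℕ} {f : F.obj (ULift.{u} (Fin n))} {x : Fin n → X}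
    {f' : F.obj (ULift.{u} (Fin n'))} {x' : Fin n' → X} (h : elt F f x = elt F f' x') :
    elt F' (a n f) x = elt F' (a n' f') x' := by
  obtain ⟨k, e, σ, τ, h₁, h₂, h₃⟩ := elt_eq_elt hF h
  have h₁ : (fun i => e (σ i)) = x := funext h₁
  have h₂ : (fun i => e (τ i)) = x' := funext h₂
  rw [← h₁, ← h₂, ← elt_elt, ← ha, h₃, ha, elt_elt]

/-- A natural transformation out of a finitary functor from its components at finite sets. -/
noncomputable def extendHom {F F' : Type u ⥤ Type u} (hF : finitary F)
    (a : ∀ n : ℕ, F.obj (ULift.{u} (Fin n)) → F'.obj (ULift.{u} (Fin n)))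
    (ha : ∀ {n k : ℕ} (f : F.obj (ULift.{u} (Fin n))) (σ : Fin n → Fin k),
      a k (elt F f fun i => ULift.up (σ i)) = elt F' (a n f) fun i => ULift.up (σ i)) :
    F ⟶ F' where
  -- A presentation of `y` is chosen; by `elt_eq_elt_of_natural` the value does not depend on it.
  app X := ↾fun y => elt F' (a _ (exists_elt hF y).choose_spec.choose)
    (exists_elt hF y).choose_spec.choose_spec.choose
  naturality X Y h := ConcreteCategory.hom_ext _ _ fun y => by
    change elt F' (a _ _) _ = F'.map h (elt F' (a _ _) _)
    rw [map_elt]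
    refine elt_eq_elt_of_natural hF a ha
      ((exists_elt hF (F.map h y)).choose_spec.choose_spec.choose_spec.trans ?_)
    rw [← map_elt, (exists_elt hF y).choose_spec.choose_spec.choose_spec]

lemma extendHom_elt {F F' : Type u ⥤ Type u} (hF : finitary F)
    (a : ∀ n : ℕ, F.obj (ULift.{u} (Fin n)) → F'.obj (ULift.{u} (Fin n))) (ha)
    {X : Type u} {n : ℕ} (f : F.obj (ULift.{u} (Fin n))) (x : Fin n → X) :
    (extendHom hF a ha).app X (elt F f x) = elt F' (a n f) x :=
  elt_eq_elt_of_natural hF a ha (exists_elt hF (elt F f x)).choose_spec.choose_spec.choose_spec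

lemma natTrans_ext_of_finitary {F F' : Type u ⥤ Type u} (hF : finitary F) {α β : F ⟶ F'}
    (h : ∀ n : ℕ, α.app (ULift.{u} (Fin n)) = β.app (ULift.{u} (Fin n))) : α = β := by
  refine NatTrans.ext (funext fun X => ConcreteCategory.hom_ext _ _ fun y => ?_)
  obtain ⟨n, f, x, rfl⟩ := exists_elt hF y
  rw [app_elt, app_elt, h]

/-- Precomposing with a morphism of variables is renaming: the multiplication meets a unit, and the
right unit law cancels both. -/
lemma lawvereCat_pre_arityMap (T : GMnd M) {n n' c : ℕ} (σ : Fin n → Fin n') {m : M}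
    (f : ((lawvereCat T).Hom n c).obj m) :
    (lawvereCat T).pre f (((lawvereJ T).map n' n).app (𝟙_ M) (arityMap σ)) =
      lawvereCat.toMap f ≫ (T.act m).map (↾fun i : ULift (Fin n) => ULift.up (σ i.down)) := by
  rw [lawvereJ_arityMap]
  change (lawvereCat.toMap f ≫ (T.act m).map (_ ≫ _) ≫ T.mult m (𝟙_ M) _) ≫
    (T.coerce (ρ_ m).hom).app _ = _
  simp only [Functor.map_comp, Category.assoc]
  rw [T.mult_unit, Category.comp_id]

/-- An element of `m * n` as a morphism `n → 1` of grade `m`. -/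
def toOp (T : GMnd M) {m : M} {n : ℕ} (f : (T.act m).obj (ULift.{u} (Fin n))) :
    ((lawvereCat T).Hom n 1).obj m :=
  show ULift.{u} (Fin 1) ⟶ (T.act m).obj (ULift.{u} (Fin n)) from ↾fun _ => f

lemma toOp_toMap (T : GMnd M) {m : M} {n : ℕ} (f : ((lawvereCat T).Hom n 1).obj m) :
    toOp T (lawvereCat.toMap f ⟨0⟩) = f :=
  lawvereCat.ext fun ⟨i⟩ => by obtain rfl := Subsingleton.elim i 0; rfl

lemma toOp_elt (T : GMnd M) {m : M} {n k : ℕ} (f : (T.act m).obj (ULift.{u} (Fin n)))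
    (σ : Fin n → Fin k) :
    toOp T (elt (T.act m) f fun i => ULift.up (σ i)) =
      (lawvereCat T).pre (toOp T f) (((lawvereJ T).map k n).app (𝟙_ M) (arityMap σ)) := by
  rw [lawvereCat_pre_arityMap]; rfl

lemma toOp_post (T : GMnd M) {m : M} {n k : ℕ} (f : ((lawvereCat T).Hom k n).obj m) (i : Fin n) :
    toOp T (lawvereCat.toMap f ⟨i⟩) =
      (lawvereCat T).post (((lawvereJ T).map n 1).app (𝟙_ M) (arityMap fun _ => i)) f := by
  rw [lawvereCat_post_arityMap]; rfl

lemma EnrFunctor.map_pre {Ob : Type v} {Ob' : Type v'} {A : EnrCat M Ob} {B : EnrCat M Ob'}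
    (F : EnrFunctor A B) {X Y Z : Ob} {m : M} (f : (A.Hom Y Z).obj m)
    (u : (A.Hom X Y).obj (𝟙_ M)) :
    (F.map X Z).app m (A.pre f u) = B.pre ((F.map Y Z).app m f) ((F.map X Y).app _ u) := by
  rw [EnrCat.pre, NatTrans.naturality_apply, F.map_comp]; rfl

lemma GLaw.Hom.map_J {L L' : GLaw M} (F : L ⟶ L') {n n' : ℕ} {m : M}
    (φ : ((arityCat M).Hom n n').obj m) :
    (F.functor.map n n').app m ((L.J.map n n').app m φ) = (L'.J.map n n').app m φ :=
  congrArg (fun G : IdObjFunctor (arityCat M) L'.cat => (G.map n n').app m φ) F.comm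

section Fullness

variable {T T' : GMnd M} (F : lawvereObj T ⟶ lawvereObj T')

/-- The action of a morphism `L_T ⟶ L_T'` on elements of `m * n`. -/
def opMap (m : M) (n : ℕ) (f : (T.act m).obj (ULift.{u} (Fin n))) :
    (T'.act m).obj (ULift.{u} (Fin n)) :=
  lawvereCat.toMap ((F.functor.map n 1).app m (toOp T f)) ⟨0⟩

lemma toOp_opMap {m : M} {n : ℕ} (f : (T.act m).obj (ULift.{u} (Fin n))) :
    toOp T' (opMap F m n f) = (F.functor.map n 1).app m (toOp T f) :=
  toOp_toMap _ _

lemma toOp_injective (T : GMnd M) {m : M} {n : ℕ} :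
    Function.Injective (toOp T : (T.act m).obj (ULift.{u} (Fin n)) → _) := fun _ _ h =>
  ConcreteCategory.congr_hom (C := Type u) h ⟨0⟩

/-- Renaming is precomposition with a morphism from `J`, which `F` preserves. -/
lemma opMap_elt {m : M} {n k : ℕ} (f : (T.act m).obj (ULift.{u} (Fin n))) (σ : Fin n → Fin k) :
    opMap F m k (elt (T.act m) f fun i => ULift.up (σ i)) =
      elt (T'.act m) (opMap F m n f) fun i => ULift.up (σ i) := by
  apply toOp_injective
  rw [toOp_opMap, toOp_elt, toOp_elt, toOp_opMap]
  refine (F.functor.toEnrFunctor.map_pre _ _).trans ?_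
  exact congrArg _ (F.map_J _)

/-- `F` fixes the projections, so its action on morphisms into `n` is determined componentwise by
its action on operations. -/
lemma toMap_map {m : M} {n k : ℕ} (f : ((lawvereCat T).Hom k n).obj m) (i : ULift.{u} (Fin n)) :
    lawvereCat.toMap ((F.functor.map k n).app m f) i = opMap F m k (lawvereCat.toMap f i) := by
  obtain ⟨i⟩ := i
  apply toOp_injective
  rw [toOp_opMap, toOp_post]
  refine (toOp_post T' _ i).trans (Eq.symm ?_)
  refine ((F.functor.toEnrFunctor.map_post _ _).trans ?_)
  exact congrArg (fun a => (lawvereCat T').post a _) (F.map_J _)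

lemma opMap_coerce {m m' : M} (w : m ⟶ m') {n : ℕ} (f : (T.act m).obj (ULift.{u} (Fin n))) :
    opMap F m' n ((T.coerce w).app _ f) = (T'.coerce w).app _ (opMap F m n f) := by
  apply toOp_injective
  rw [toOp_opMap]
  exact ((F.functor.map n 1).naturality_apply w (toOp T f)).trans
    (congrArg (((lawvereCat T').Hom n 1).map w) (toOp_opMap F f).symm)

lemma opMap_unit {n : ℕ} (i : ULift.{u} (Fin n)) :
    opMap F (𝟙_ M) n (T.unit _ i) = T'.unit _ i := by
  have h := F.functor.map_one n
  have h' := toMap_map F ((lawvereCat T).one n) i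
  exact h'.symm.trans (congrArg (fun a => lawvereCat.toMap a i) h)

lemma opMap_mult {m₁ m₂ : M} {n k : ℕ} (f : (T.act m₁).obj (ULift.{u} (Fin n)))
    (g : Fin n → (T.act m₂).obj (ULift.{u} (Fin k))) :
    opMap F (m₁ ⊗ m₂) k (T.mult m₁ m₂ _ (elt (T.act m₁) f g)) =
      T'.mult m₁ m₂ _ (elt (T'.act m₁) (opMap F m₁ n f) fun i => opMap F m₂ k (g i)) := by
  -- The family `g` is a single morphism `k → n`, so the left-hand side involves a composite, which
  -- `F` preserves.
  let g' : ((lawvereCat T).Hom k n).obj m₂ :=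
    show ULift.{u} (Fin n) ⟶ (T.act m₂).obj (ULift.{u} (Fin k)) from ↾fun i => g i.down
  have h := F.functor.map_comp (toOp T f) g'
  have h' := congrArg (fun a => lawvereCat.toMap a ⟨0⟩) h
  have e : (fun i : ULift.{u} (Fin n) => opMap F m₂ k (g i.down)) =
      fun i => lawvereCat.toMap ((F.functor.map k n).app m₂ g') i :=
    funext fun i => (toMap_map F g' i).symm
  refine Eq.trans ?_ (h'.trans ?_)
  · exact (toMap_map F ((lawvereCat T).comp (toOp T f) g') ⟨0⟩).symm
  · refine congrArg (T'.mult m₁ m₂ _) ?_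
    exact congrArg (fun a => (T'.act m₁).map (↾a) (opMap F m₁ n f)) e.symm

/-- The components of the morphism of graded monads induced by `L_T ⟶ L_T'`. -/
noncomputable def opComponent (m : M) : T.act m ⟶ T'.act m :=
  extendHom (T.finitary_act m) (opMap F m) (opMap_elt F)

lemma opComponent_elt {m : M} {X : Type u} {n : ℕ} (f : (T.act m).obj (ULift.{u} (Fin n)))
    (x : Fin n → X) :
    (opComponent F m).app X (elt (T.act m) f x) = elt (T'.act m) (opMap F m n f) x :=
  extendHom_elt _ _ _ _ _

lemma opComponent_app {m : M} {n : ℕ} (f : (T.act m).obj (ULift.{u} (Fin n))) :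
    (opComponent F m).app _ f = opMap F m n f := by
  have := opComponent_elt F f ULift.up
  rwa [elt_up, elt_up] at this

lemma mult_map_apply (T : GMnd M) {m₁ m₂ : M} {X Y : Type u} (h : X ⟶ Y)
    (y : (T.act m₁).obj ((T.act m₂).obj X)) :
    T.mult m₁ m₂ Y ((T.act m₁).map ((T.act m₂).map h) y) =
      (T.act (m₁ ⊗ m₂)).map h (T.mult m₁ m₂ X y) :=
  ConcreteCategory.congr_hom (T.mult_naturality m₁ m₂ h) y

/-- A finite family of elements of `F X` for finitary `F` comes from a single finite set. -/
lemma exists_elt_family {F : Type u ⥤ Type u} (hF : finitary F) {X : Type u} {n : ℕ}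
    (y : Fin n → F.obj X) :
    ∃ (k : ℕ) (z : Fin k → X) (g : Fin n → F.obj (ULift.{u} (Fin k))), ∀ i, elt F (g i) z = y i := by
  choose l f x h using fun i => exists_elt hF (y i)
  obtain ⟨k, z, σ, -, hz⟩ := exists_injective_factor (fun i : Σ i, Fin (l i) => x i.1 i.2)
  refine ⟨k, z, fun i => elt F (f i) fun j => ULift.up (σ ⟨i, j⟩), fun i => ?_⟩
  rw [elt_elt, ← h]
  exact congrArg (elt F (f i)) (funext fun j => hz ⟨i, j⟩)

/-- The morphism of graded monads inducing a given `L_T ⟶ L_T'`. -/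
noncomputable def opHom : T ⟶ T' :=
  GMnd.homMk (opComponent F)
    (fun {m m'} w => natTrans_ext_of_finitary (T.finitary_act m) fun n =>
      ConcreteCategory.hom_ext _ _ fun f => by
        change (opComponent F m').app _ _ = (T'.coerce w).app _ ((opComponent F m).app _ f)
        erw [opComponent_app, opComponent_app]
        exact opMap_coerce F w f)
    (fun X => ConcreteCategory.hom_ext _ _ fun x => by
      -- Naturality of the units along the map picking out `x` reduces the claim to a one-element
      -- set.
      have h₁ := ConcreteCategory.congr_hom
        (T.unit_naturality (↾fun _ : ULift.{u} (Fin 1) => x)) ⟨0⟩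
      have h₂ := ConcreteCategory.congr_hom
        (T'.unit_naturality (↾fun _ : ULift.{u} (Fin 1) => x)) ⟨0⟩
      refine (congrArg ((opComponent F (𝟙_ M)).app X) h₁).trans (Eq.trans ?_ h₂.symm)
      refine (opComponent_elt F (T.unit _ ⟨0⟩) fun _ : Fin 1 => x).trans ?_
      rw [opMap_unit]; rfl)
    (fun m₁ m₂ X => ConcreteCategory.hom_ext _ _ fun y => by
      change (opComponent F (m₁ ⊗ m₂)).app X (T.mult m₁ m₂ X y) = T'.mult m₁ m₂ X
        ((T'.act m₁).map ((opComponent F m₂).app X) ((opComponent F m₁).app _ y))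
      obtain ⟨n, f, x, rfl⟩ := exists_elt (T.finitary_act m₁) y
      -- All inner elements are written over the same variables `z`. Naturality of the
      -- multiplications along `z` then reduces the claim to the finite set `k`, where it is
      -- `opMap_mult`.
      obtain ⟨k, z, g, hg⟩ := exists_elt_family (T.finitary_act m₂) x
      let z' : ULift.{u} (Fin k) ⟶ X := ↾fun i => z i.down
      obtain rfl : (fun i => (T.act m₂).map z' (g i)) = x := funext hg
      rw [opComponent_elt, map_elt]
      have h₁ (i : Fin n) : (opComponent F m₂).app X ((T.act m₂).map z' (g i)) =
          (T'.act m₂).map z' (opMap F m₂ k (g i)) := opComponent_elt F (g i) z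
      simp only [h₁]
      rw [← map_elt ((T.act m₂).map z'), ← map_elt ((T'.act m₂).map z'), mult_map_apply,
        mult_map_apply, ← opMap_mult]
      exact opComponent_elt F _ z)

lemma lawvereMap_opHom : lawvereMap (opHom F) = F := by
  apply GLaw.Hom.ext; ext1; funext n n'; ext m f
  refine lawvereCat.ext fun i => ?_
  exact (opComponent_app F _).trans (toMap_map F f i).symm

end Fullness

instance : (lawvereFunctor M).Full where
  map_surjective F := ⟨opHom F, lawvereMap_opHom F⟩

/-- The component of `α` at a finite set is recovered from the action of `L_α` on operations. -/
instance : (lawvereFunctor M).Faithful where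
  map_injective {T T'} _ _ h := GMnd.hom_ext fun m =>
    natTrans_ext_of_finitary (T.finitary_act m) fun n => ConcreteCategory.hom_ext _ _ fun f =>
      congrArg (fun G : lawvereObj T ⟶ lawvereObj T' =>
        lawvereCat.toMap ((G.functor.map n 1).app m (toOp T f)) ⟨0⟩) h

end FullyFaithful

/-! ### The coend formula for any monad whose theory is `L`. -/

section TermsOfLawvere

variable {M : Type u} [SmallCategory M] [MonoidalCategory M]

/-- The morphism `n' → n` of `L` of grade `I` given by a function `n → n'`. -/
def GLaw.base (L : GLaw M) {n n' : ℕ} (σ : Fin n → Fin n') : (L.cat.Hom n' n).obj (𝟙_ M) :=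
  (L.J.map n' n).app (𝟙_ M) (arityMap σ)

/-- The leg of a cowedge under `(n', n) ↦ L(n, 1) m × X^n'`. -/
def cowedgeLeg {L : GLaw M} {m : M} {X : Type u} (E : Cowedge (termBifunctor L m X)) {n : ℕ}
    (f : (L.cat.Hom n 1).obj m) (x : Fin n → X) : E.pt :=
  (show ((L.cat.Hom n 1).obj m × (Fin n → X) : Type u) ⟶ E.pt from E.π ⟨n⟩) (f, x)

lemma cowedgeLeg_pre {L : GLaw M} {m : M} {X : Type u} (E : Cowedge (termBifunctor L m X))
    {n n' : ℕ} (σ : Fin n → Fin n') (f : (L.cat.Hom n 1).obj m) (x : Fin n' → X) :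
    cowedgeLeg E f (fun i => x (σ i)) = cowedgeLeg E (L.cat.pre f (L.base σ)) x := by
  have h := Cowedge.condition E (i := ⟨n⟩) (j := ⟨n'⟩) σ
  exact congrArg (fun t : ((L.cat.Hom n 1).obj m × (Fin n' → X) : Type u) ⟶ E.pt => t (f, x)) h

/-- A concrete criterion for a coend of this shape: the legs are jointly surjective, and pairs with
equal images are linked by one common renaming. Every cowedge then takes equal values on such pairs,
so it factors uniquely. -/
lemma nonempty_isColimit_cowedge (L : GLaw M) (m : M) (X Y : Type u)
    (κ : ∀ n : ℕ, (L.cat.Hom n 1).obj m × (Fin n → X) → Y)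
    (hκ : ∀ ⦃n n' : Aleph0⦄ (σ : n ⟶ n'), ((termBifunctor L m X).map σ.op).app n ≫ ↾(κ n.card) =
      ((termBifunctor L m X).obj (op n')).map σ ≫ ↾(κ n'.card))
    (hsurj : ∀ y, ∃ (n : ℕ) (f : (L.cat.Hom n 1).obj m) (x : Fin n → X), κ n (f, x) = y)
    (hinj : ∀ {n n' : ℕ} (f : (L.cat.Hom n 1).obj m) (x : Fin n → X) (f' : (L.cat.Hom n' 1).obj m)
      (x' : Fin n' → X), κ n (f, x) = κ n' (f', x') →
      ∃ (k : ℕ) (e : Fin k → X) (σ : Fin n → Fin k) (τ : Fin n' → Fin k), (∀ i, e (σ i) = x i) ∧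
        (∀ i, e (τ i) = x' i) ∧
        L.cat.pre f (L.base σ) = L.cat.pre f' (L.base τ)) :
    Nonempty (IsColimit (Cowedge.mk (F := termBifunctor L m X) Y (fun n => ↾(κ n.card)) hκ)) := by
  have key (E : Cowedge (termBifunctor L m X)) {n n' : ℕ} {f : (L.cat.Hom n 1).obj m}
      {x : Fin n → X} {f' : (L.cat.Hom n' 1).obj m} {x' : Fin n' → X}
      (h : κ n (f, x) = κ n' (f', x')) : cowedgeLeg E f x = cowedgeLeg E f' x' := by
    obtain ⟨k, e, σ, τ, h₁, h₂, h₃⟩ := hinj f x f' x' h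
    have h₁ : (fun i => e (σ i)) = x := funext h₁
    have h₂ : (fun i => e (τ i)) = x' := funext h₂
    rw [← h₁, ← h₂, cowedgeLeg_pre, h₃, ← cowedgeLeg_pre]
  choose N g z hz using hsurj
  refine ⟨Multicofork.IsColimit.mk _ (fun E => ↾fun y => cowedgeLeg E (g y) (z y)) (fun E n => ?_)
    fun E d hd => ?_⟩
  · exact ConcreteCategory.hom_ext _ _ fun ⟨f, x⟩ => key E (hz (κ n.card (f, x)))
  · refine ConcreteCategory.hom_ext _ _ fun y => ?_
    exact (congrArg d (hz y).symm).trans (congrArg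
      (fun t : ((L.cat.Hom (N y) 1).obj m × (Fin (N y) → X) : Type u) ⟶ E.pt => t (g y, z y))
      (hd ⟨N y⟩))

section

variable {L : GLaw M} {T : GMnd M} (φ : L ⟶ lawvereObj T)

/-- The action of a morphism `L ⟶ L_T` on operations. -/
def opOf {n : ℕ} {m : M} (f : (L.cat.Hom n 1).obj m) : (T.act m).obj (ULift.{u} (Fin n)) :=
  lawvereCat.toMap ((φ.functor.map n 1).app m f) ⟨0⟩

lemma toOp_opOf {n : ℕ} {m : M} (f : (L.cat.Hom n 1).obj m) :
    toOp T (opOf φ f) = (φ.functor.map n 1).app m f :=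
  toOp_toMap _ _

lemma opOf_pre {n k : ℕ} {m : M} (σ : Fin n → Fin k) (f : (L.cat.Hom n 1).obj m) :
    opOf φ (L.cat.pre f (L.base σ)) =
      elt (T.act m) (opOf φ f) fun i => ULift.up (σ i) := by
  apply toOp_injective
  rw [toOp_opOf, toOp_elt, toOp_opOf]
  refine (φ.functor.toEnrFunctor.map_pre _ _).trans ?_
  exact congrArg _ (φ.map_J _)

lemma opOf_map {n : ℕ} {m m' : M} (w : m ⟶ m') (f : (L.cat.Hom n 1).obj m) :
    opOf φ ((L.cat.Hom n 1).map w f) = (T.coerce w).app _ (opOf φ f) := by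
  apply toOp_injective
  rw [toOp_opOf]
  exact ((φ.functor.map n 1).naturality_apply w f).trans
    (congrArg (((lawvereCat T).Hom n 1).map w) (toOp_opOf φ f).symm)

lemma opOf_one : opOf φ (L.cat.one 1) = T.unit _ ⟨0⟩ :=
  congrArg (fun a => lawvereCat.toMap a ⟨0⟩) (φ.functor.map_one 1)

lemma opOf_post {n k : ℕ} {m : M} (g : (L.cat.Hom k n).obj m) (i : Fin n) :
    opOf φ (L.cat.post (L.π i) g) = lawvereCat.toMap ((φ.functor.map k n).app m g) ⟨i⟩ := by
  apply toOp_injective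
  rw [toOp_opOf]
  refine Eq.trans ?_ (toOp_post T _ i).symm
  refine (φ.functor.toEnrFunctor.map_post _ _).trans ?_
  exact congrArg (fun a => (lawvereCat T).post a _) (φ.map_J _)

/-- Composition in `L_T` is defined through `mult`, and the components of the image of `g` are the
images of `π_i ∘ g`. -/
lemma opOf_comp {n k : ℕ} {m₁ m₂ : M} (f : (L.cat.Hom n 1).obj m₁) (g : (L.cat.Hom k n).obj m₂) :
    opOf φ (L.cat.comp f g) =
      T.mult m₁ m₂ _ (elt (T.act m₁) (opOf φ f) fun i => opOf φ (L.cat.post (L.π i) g)) := by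
  have h := congrArg (fun a => lawvereCat.toMap a ⟨0⟩) (φ.functor.map_comp f g)
  refine h.trans (congrArg (T.mult m₁ m₂ _) ?_)
  exact congrArg (fun a => (T.act m₁).map (↾a) (opOf φ f))
    (funext fun i => (opOf_post φ g i.down).symm)

lemma opOf_bijective (hφ : ∀ (n : ℕ) (m : M), Function.Bijective ((φ.functor.map n 1).app m))
    (n : ℕ) (m : M) : Function.Bijective (opOf φ (n := n) (m := m)) := by
  refine ⟨fun f g h => (hφ n m).1 ?_, fun a => ?_⟩
  · rw [← toOp_opOf, ← toOp_opOf, h]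
  · obtain ⟨f, hf⟩ := (hφ n m).2 (toOp T a)
    exact ⟨f, toOp_injective T ((toOp_opOf φ f).trans hf)⟩

/-- A graded monad whose Lawvere theory is isomorphic to `L` is the graded monad of terms of `L`. -/
def termMonadOfBijective
    (hφ : ∀ (n : ℕ) (m : M), Function.Bijective ((φ.functor.map n 1).app m)) : TermMonad L T where
  κ m X n y := elt (T.act m) (opOf φ y.1) y.2
  dinatural m X n n' σ := ConcreteCategory.hom_ext _ _ fun ⟨f, x⟩ =>
    (elt_elt (opOf φ f) σ x).symm.trans (congrArg (fun a => elt (T.act m) a x) (opOf_pre φ σ f).symm)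
  isCoend m X := by
    refine nonempty_isColimit_cowedge L m X _
      (fun n y => elt (T.act m) (opOf φ y.1) y.2) _ (fun y => ?_) fun f x f' x' h => ?_
    · obtain ⟨n, f, x, rfl⟩ := exists_elt (T.finitary_act m) y
      obtain ⟨f, rfl⟩ := (opOf_bijective φ hφ n m).2 f
      exact ⟨n, f, x, rfl⟩
    · obtain ⟨k, e, σ, τ, h₁, h₂, h₃⟩ := elt_eq_elt (T.finitary_act m) h
      refine ⟨k, e, σ, τ, h₁, h₂, (opOf_bijective φ hφ k m).1 ?_⟩
      rw [opOf_pre, opOf_pre, h₃]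
  coerce_κ w X n f x := by
    rw [app_elt, opOf_map]
  map_κ m X Y h n f x := map_elt _ _ _
  unit_κ X x := by
    rw [opOf_one]
    exact ConcreteCategory.congr_hom (T.unit_naturality (↾fun _ : ULift.{u} (Fin 1) => x)) ⟨0⟩
  mult_κ m₁ m₂ X n k f g x := by
    let x' : ULift.{u} (Fin k) ⟶ X := ↾fun i => x i.down
    -- Naturality along `x` pulls the equation back to the set of variables `k`, where it is
    -- `opOf_comp`.
    refine (congrArg (T.mult m₁ m₂ X) (map_elt ((T.act m₂).map x') (opOf φ f)
      fun i => opOf φ (L.cat.post (L.π i) g)).symm).trans ?_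
    rw [mult_map_apply, ← opOf_comp]
    rfl

end

end TermsOfLawvere

/-! ### Calculus of grade `I` morphisms in an enriched category. -/

section TermMonadConstruction

variable {M : Type u} [SmallCategory M] [MonoidalCategory M]

namespace EnrCat

variable {Ob : Type v} (A : EnrCat M Ob) {X Y Z W : Ob} {m m₁ m₂ : M}

lemma post_one (u : (A.Hom X Y).obj (𝟙_ M)) : A.post u (A.one X) = u := by
  rw [post, unitors_equal]; exact A.comp_one u

lemma one_pre (u : (A.Hom X Y).obj (𝟙_ M)) : A.pre (A.one Y) u = u := by
  rw [pre, ← unitors_equal]; exact A.one_comp u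

/-- This law and the following ones let grade `I` morphisms be composed as in an ordinary category.
The sides become the same composite transported along structural isomorphisms that agree by
coherence or naturality. -/
lemma comp_post (u : (A.Hom Z W).obj (𝟙_ M)) (g : (A.Hom Y Z).obj m₁) (f : (A.Hom X Y).obj m₂) :
    A.comp (A.post u g) f = A.post u (A.comp g f) := by
  simp only [post, comp_map_left, ← A.assoc, ← Functor.map_comp_apply]
  congr 2
  simp

lemma comp_pre (g : (A.Hom Z W).obj m₁) (f : (A.Hom Y Z).obj m₂) (u : (A.Hom X Y).obj (𝟙_ M)) :
    A.comp g (A.pre f u) = A.pre (A.comp g f) u := by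
  simp only [pre, comp_map_right, ← A.assoc, ← Functor.map_comp_apply]
  congr 2
  simp

lemma pre_comp (g : (A.Hom Z W).obj m₁) (u : (A.Hom Y Z).obj (𝟙_ M)) (f : (A.Hom X Y).obj m₂) :
    A.comp (A.pre g u) f = A.comp g (A.post u f) := by
  simp only [pre, post, comp_map_left, comp_map_right, ← A.assoc, ← Functor.map_comp_apply]
  congr 2
  simp

lemma post_pre (u : (A.Hom Z W).obj (𝟙_ M)) (f : (A.Hom Y Z).obj m) (w : (A.Hom X Y).obj (𝟙_ M)) :
    A.post u (A.pre f w) = A.pre (A.post u f) w := by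
  simp only [pre, post, comp_map_left, comp_map_right, ← A.assoc, ← Functor.map_comp_apply]
  congr 2
  simp

lemma post_map (u : (A.Hom Y Z).obj (𝟙_ M)) (w : m₁ ⟶ m₂) (f : (A.Hom X Y).obj m₁) :
    A.post u ((A.Hom X Y).map w f) = (A.Hom X Z).map w (A.post u f) := by
  simp only [post, comp_map_right, ← Functor.map_comp_apply]
  congr 2
  simp

lemma map_pre (f : (A.Hom Y Z).obj m₁) (w : m₁ ⟶ m₂) (u : (A.Hom X Y).obj (𝟙_ M)) :
    A.pre ((A.Hom Y Z).map w f) u = (A.Hom X Z).map w (A.pre f u) := by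
  simp only [pre, comp_map_left, ← Functor.map_comp_apply]
  congr 2
  simp

end EnrCat

/-! ### The term monad of a graded Lawvere theory. -/

namespace GLaw

variable (L : GLaw M) {n n' k : ℕ} {m m' : M}

lemma post_π_base (σ : Fin n → Fin n') (i : Fin n) :
    L.cat.post (L.π i) (L.base σ) = L.π (σ i) := by
  refine (L.J.toEnrFunctor.map_post _ _).symm.trans ?_
  exact congrArg ((L.J.map n' 1).app (𝟙_ M)) (arityMap_comp (fun _ => i) σ).symm

lemma base_id : L.base (fun i : Fin n => i) = L.cat.one n :=
  (congrArg ((L.J.map n n).app (𝟙_ M)) (arityMap_id n)).trans (L.J.map_one n)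

lemma π_zero : L.π (0 : Fin 1) = L.cat.one 1 := by
  rw [← base_id]
  exact congrArg (fun σ => L.base σ) (funext fun i => Subsingleton.elim (α := Fin 1) 0 i)

lemma post_π_zero (f : (L.cat.Hom n 1).obj m) : L.cat.post (L.π 0) f = f := by
  rw [π_zero]; exact L.cat.one_comp f

/-- In the category of arities, `n` is the cotensor of `1` by `n`. -/
lemma arity_isCotensor (n : ℕ) : IsCotensor (arityCat M) (copow M n) 1 n
    (copowHom (F := (arityCat M).Hom n 1) fun i => arityMap fun _ => i) := by
  rw [isCotensor_iff]
  intro k m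
  let e₁ := copowEquiv (n := n) (copow M k) m
  let e₂ := copowEquiv (n := 1) (copow M k) m
  let e₃ : (Fin n → (copow M k).obj m) ≃ (Fin n → Fin 1 → (copow M k).obj m) :=
    Equiv.piCongrRight fun _ => (Equiv.funUnique (Fin 1) _).symm
  have : (fun (f : ((arityCat M).Hom k n).obj m) (i : Fin n) =>
      (arityCat M).post (proj (A := arityCat M) (C := 1) (P := n)
        (copowHom fun i => arityMap fun _ => i) i) f) =
      (e₁.trans (e₃.trans (Equiv.piCongrRight fun _ => e₂.symm))) := by
    funext f i
    apply e₂.injective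
    erw [proj_copowHom, copowEquiv_post_arityMap]
    exact (e₂.apply_symm_apply _).symm
  rw [this]
  exact Equiv.bijective _

/-- `J` preserves the cotensor of `1` by `n`, which in the arities is `n` itself; its unit is
carried to the projections `π_i`. -/
lemma π_bijective (k n : ℕ) (m : M) :
    Function.Bijective fun (f : (L.cat.Hom k n).obj m) (i : Fin n) => L.cat.post (L.π i) f := by
  have h := (isCotensor_iff _).1 (L.preserves n 1 n _ (arity_isCotensor n)) k m
  have e (i : Fin n) : proj (A := L.cat) (copowHom (F := (arityCat M).Hom n 1)
      (fun i => arityMap fun _ => i) ≫ L.J.toEnrFunctor.map n 1) i = L.π i :=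
    congrArg ((L.J.map n 1).app (𝟙_ M))
      (proj_copowHom (A := arityCat M) (fun i => arityMap fun _ => i) i)
  simp only [e] at h
  exact h

lemma hom_ext {f g : (L.cat.Hom k n).obj m}
    (h : ∀ i, L.cat.post (L.π i) f = L.cat.post (L.π i) g) : f = g :=
  (L.π_bijective k n m).1 (funext h)

/-- The functor `m ↦ L(-, 1) m`. -/
def termFunctors : M ⥤ Aleph0 ⥤ Type u where
  obj m := termFunctor L m
  map w :=
    { app := fun n => (L.cat.Hom n.card 1).map w
      naturality := fun _ _ σ => ConcreteCategory.hom_ext _ _ fun f =>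
        (L.cat.map_pre f w (L.base σ)).symm }
  map_id m := NatTrans.ext (funext fun n => (L.cat.Hom n.card 1).map_id m)
  map_comp w w' := NatTrans.ext (funext fun n => (L.cat.Hom n.card 1).map_comp w w')

/-- The functor `m ↦ (X ↦ ∫^n L(n, 1) m × X^n)`. -/
def termEndofunctors : M ⥤ (Type u ⥤ Type u) where
  obj m := Aleph0.Ext.functor (termFunctor L m)
  map w := Aleph0.Ext.functorMap (L.termFunctors.map w)
  map_id m := NatTrans.ext (funext fun X => ConcreteCategory.hom_ext _ _ fun y => by
    obtain ⟨n, f, x, rfl⟩ := Aleph0.Ext.exists_rep y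
    exact congrArg (fun a => Aleph0.Ext.mk (termFunctor L m) a x)
      (ConcreteCategory.congr_hom ((L.cat.Hom n 1).map_id m) f))
  map_comp w w' := NatTrans.ext (funext fun X => ConcreteCategory.hom_ext _ _ fun y => by
    obtain ⟨n, f, x, rfl⟩ := Aleph0.Ext.exists_rep y
    rw [Functor.map_comp]; rfl)

/-- The set `∫^n L(n, 1) m × X^n` of terms. -/
abbrev Term (m : M) (X : Type u) : Type u := Aleph0.Ext (termFunctor L m) X

/-- The term `f(x)`. -/
def term {X : Type u} (f : (L.cat.Hom n 1).obj m) (x : Fin n → X) : L.Term m X :=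
  Aleph0.Ext.mk (termFunctor L m) f x

variable {X Y : Type u}

lemma exists_term (y : L.Term m X) :
    ∃ (n : ℕ) (f : (L.cat.Hom n 1).obj m) (x : Fin n → X), L.term f x = y :=
  Aleph0.Ext.exists_rep y

lemma term_pre (σ : Fin n → Fin n') (f : (L.cat.Hom n 1).obj m) (x : Fin n' → X) :
    L.term (L.cat.pre f (L.base σ)) x = L.term f fun i => x (σ i) :=
  Aleph0.Ext.mk_ren (G := termFunctor L m) σ f x

lemma term_eq_term_iff {f : (L.cat.Hom n 1).obj m} {x : Fin n → X}
    {f' : (L.cat.Hom n' 1).obj m} {x' : Fin n' → X} :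
    L.term f x = L.term f' x' ↔ ∃ (k : ℕ) (e : Fin k → X) (σ : Fin n → Fin k) (τ : Fin n' → Fin k),
      Function.Injective e ∧ (∀ i, e (σ i) = x i) ∧ (∀ i, e (τ i) = x' i) ∧
        L.cat.pre f (L.base σ) = L.cat.pre f' (L.base τ) :=
  Aleph0.Ext.mk_eq_mk_iff

lemma exists_term_family (y : Fin n → L.Term m X) :
    ∃ (k : ℕ) (g : (L.cat.Hom k n).obj m) (x : Fin k → X),
      (fun i => L.term (L.cat.post (L.π i) g) x) = y := by
  choose l f x h using fun i => L.exists_term (y i)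
  obtain ⟨k, z, σ, -, hz⟩ := exists_injective_factor (fun i : Σ i, Fin (l i) => x i.1 i.2)
  -- The operations, renamed into the common variables `z`, are tupled into one morphism.
  obtain ⟨g, hg⟩ := (L.π_bijective k n m).2 fun i => L.cat.pre (f i) (L.base fun j => σ ⟨i, j⟩)
  refine ⟨k, g, z, funext fun i => ?_⟩
  rw [← h, show L.cat.post (L.π i) g = _ from congrFun hg i, term_pre]
  exact congrArg (L.term (f i)) (funext fun j => hz ⟨i, j⟩)

lemma base_base_pre {l : ℕ} (σ : Fin n → Fin n') (τ : Fin n' → Fin l)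
    (f : (L.cat.Hom n k).obj m) :
    L.cat.pre (L.cat.pre f (L.base σ)) (L.base τ) = L.cat.pre f (L.base fun i => τ (σ i)) := by
  rw [L.cat.pre_pre]
  refine congrArg (L.cat.pre f) ((L.J.toEnrFunctor.map_post _ _).symm.trans ?_)
  exact congrArg ((L.J.map l n).app (𝟙_ M)) (arityMap_comp σ τ).symm

/-- Independence of substitution from the presentation of the family. Each component gives its own
common renaming; enumerate `x`, `x'` and all these witnesses by one injective `z`. Renamed into `z`,
the morphisms `g` and `g'` agree after every projection, hence are equal. -/
lemma term_comp_congr (f : (L.cat.Hom n 1).obj m') {k' : ℕ} {g : (L.cat.Hom k n).obj m}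
    {x : Fin k → X} {g' : (L.cat.Hom k' n).obj m} {x' : Fin k' → X}
    (h : (fun i => L.term (L.cat.post (L.π i) g) x) =
      fun i => L.term (L.cat.post (L.π i) g') x') :
    L.term (L.cat.comp f g) x = L.term (L.cat.comp f g') x' := by
  choose l e σ τ he h₁ h₂ h₃ using fun i => L.term_eq_term_iff.1 (congrFun h i)
  obtain ⟨p, z, ψ, hz, hψ⟩ := exists_injective_factor
    (Sum.elim (Sum.elim x x') fun i : Σ i, Fin (l i) => e i.1 i.2)
  have hx (i) : z (ψ (.inl (.inl i))) = x i := hψ _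
  have hx' (i) : z (ψ (.inl (.inr i))) = x' i := hψ _
  have he (i j) : z (ψ (.inr ⟨i, j⟩)) = e i j := hψ _
  have key : L.cat.pre g (L.base fun i => ψ (.inl (.inl i))) =
      L.cat.pre g' (L.base fun i => ψ (.inl (.inr i))) := by
    refine L.hom_ext fun i => ?_
    have e₁ : (fun j => ψ (.inl (.inl j))) = fun j => ψ (.inr ⟨i, σ i j⟩) :=
      funext fun j => hz (by rw [hx, he, h₁])
    have e₂ : (fun j => ψ (.inl (.inr j))) = fun j => ψ (.inr ⟨i, τ i j⟩) :=
      funext fun j => hz (by rw [hx', he, h₂])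
    rw [L.cat.post_pre, L.cat.post_pre, e₁, e₂,
      ← L.base_base_pre (σ i) fun j => ψ (.inr ⟨i, j⟩), h₃, L.base_base_pre]
  have e₁ := L.term_pre (fun i => ψ (.inl (.inl i))) (L.cat.comp f g) z
  have e₂ := L.term_pre (fun i => ψ (.inl (.inr i))) (L.cat.comp f g') z
  rw [← L.cat.comp_pre] at e₁ e₂
  rw [← funext hx, ← funext hx', ← e₁, ← e₂, key]

/-- Substitution of a family of terms in an operation. -/
noncomputable def subst (f : (L.cat.Hom n 1).obj m') (y : Fin n → L.Term m X) :
    L.Term (m' ⊗ m) X :=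
  L.term (L.cat.comp f (L.exists_term_family y).choose_spec.choose)
    (L.exists_term_family y).choose_spec.choose_spec.choose

lemma subst_term (f : (L.cat.Hom n 1).obj m') (g : (L.cat.Hom k n).obj m) (x : Fin k → X) :
    (L.subst f fun i => L.term (L.cat.post (L.π i) g) x) = L.term (L.cat.comp f g) x :=
  L.term_comp_congr f (L.exists_term_family _).choose_spec.choose_spec.choose_spec

/-- Dinaturality in the outer operation, which lets substitution descend to the coend. Presenting
`y` by one morphism makes it associativity of composition. -/
lemma subst_pre (σ : Fin n → Fin n') (f : (L.cat.Hom n 1).obj m') (y : Fin n' → L.Term m X) :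
    L.subst (L.cat.pre f (L.base σ)) y = L.subst f fun i => y (σ i) := by
  obtain ⟨k, g, x, rfl⟩ := L.exists_term_family y
  rw [subst_term, L.cat.pre_comp, ← subst_term]
  congr 1
  funext i
  rw [L.cat.post_post, post_π_base]

/-- Substitution of terms. -/
noncomputable def termMult (m₁ m₂ : M) (X : Type u) : L.Term m₁ (L.Term m₂ X) → L.Term (m₁ ⊗ m₂) X :=
  Aleph0.Ext.desc (fun _ f y => L.subst f y) fun σ f y => L.subst_pre σ f y

lemma termMult_term {m₁ m₂ : M} (f : (L.cat.Hom n 1).obj m₁) (g : (L.cat.Hom k n).obj m₂)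
    (x : Fin k → X) :
    L.termMult m₁ m₂ X (L.term f fun i => L.term (L.cat.post (L.π i) g) x) =
      L.term (L.cat.comp f g) x :=
  L.subst_term f g x

lemma exists_term_term {m₁ m₂ : M} (y : L.Term m₁ (L.Term m₂ X)) :
    ∃ (n k : ℕ) (f : (L.cat.Hom n 1).obj m₁) (g : (L.cat.Hom k n).obj m₂) (x : Fin k → X),
      (L.term f fun i => L.term (L.cat.post (L.π i) g) x) = y := by
  obtain ⟨n, f, z, rfl⟩ := L.exists_term y
  obtain ⟨k, g, x, rfl⟩ := L.exists_term_family z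
  exact ⟨n, k, f, g, x, rfl⟩

lemma termEndofunctors_map_app_term {w : m ⟶ m'} (f : (L.cat.Hom n 1).obj m) (x : Fin n → X) :
    (L.termEndofunctors.map w).app X (L.term f x) = L.term ((L.cat.Hom n 1).map w f) x := rfl

lemma term_π (i : Fin n) (x : Fin n → X) : L.term (L.π i) x = L.term (L.cat.one 1) fun _ => x i := by
  rw [← L.term_pre (fun _ : Fin 1 => i)]
  congr 1
  exact (L.cat.one_pre _).symm

/-- The graded monad of terms of `L`. -/
noncomputable def termMonad : GMnd M :=
  GMnd.ofData L.termEndofunctors (fun m => Aleph0.Ext.finitary_functor _)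
    { app := fun X => ↾fun x => L.term (L.cat.one 1) fun _ => x }
    (fun m₁ m₂ =>
      { app := fun X => ↾L.termMult m₁ m₂ X
        naturality := fun X Y h => ConcreteCategory.hom_ext _ _ fun y => by
          obtain ⟨n, k, f, g, x, rfl⟩ := L.exists_term_term y
          exact (L.termMult_term f g _).trans
            (congrArg ((L.termEndofunctors.obj _).map h) (L.termMult_term f g x).symm) })
    (fun {m₁ m₁' m₂ m₂'} w₁ w₂ X => ConcreteCategory.hom_ext _ _ fun y => by
      obtain ⟨n, k, f, g, x, rfl⟩ := L.exists_term_term y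
      change L.termMult m₁' m₂' X (L.term ((L.cat.Hom n 1).map w₁ f) fun i =>
        L.term ((L.cat.Hom k 1).map w₂ (L.cat.post (L.π i) g)) x) =
          (L.termEndofunctors.map (w₁ ⊗ₘ w₂)).app X (L.termMult m₁ m₂ X (L.term f fun i =>
            L.term (L.cat.post (L.π i) g) x))
      simp only [← L.cat.post_map]
      rw [L.termMult_term, L.termMult_term, L.cat.comp_natural]
      rfl)
    (fun m₁ m₂ m₃ X => ConcreteCategory.hom_ext _ _ fun y => by
      obtain ⟨n, k, f, g, z, rfl⟩ := L.exists_term_term y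
      -- The three layers are now single morphisms `f`, `g`, `h`, and the law reduces to
      -- associativity of composition in `L`.
      obtain ⟨l, h, x, rfl⟩ := L.exists_term_family z
      change (L.termEndofunctors.map (α_ m₁ m₂ m₃).hom).app X (L.termMult (m₁ ⊗ m₂) m₃ X
        (L.termMult m₁ m₂ _ (L.term f fun i => L.term (L.cat.post (L.π i) g) fun j =>
          L.term (L.cat.post (L.π j) h) x))) = L.termMult m₁ (m₂ ⊗ m₃) X (L.term f fun i =>
          L.termMult m₂ m₃ X (L.term (L.cat.post (L.π i) g) fun j =>
            L.term (L.cat.post (L.π j) h) x))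
      simp only [L.termMult_term, L.cat.comp_post]
      rw [← L.cat.assoc]
      rfl)
    (fun m X => ConcreteCategory.hom_ext _ _ fun y => by
      obtain ⟨n, f, x, rfl⟩ := L.exists_term y
      change (L.termEndofunctors.map (λ_ m).hom).app X (L.termMult (𝟙_ M) m X
        (L.term (L.cat.one 1) fun _ => L.term f x)) = L.term f x
      -- Since `π_0` is the identity of `1`, the operation `f` is its own only component.
      have e : (fun _ : Fin 1 => L.term f x) = fun i => L.term (L.cat.post (L.π i) f) x := by
        funext i
        obtain rfl := Subsingleton.elim i 0
        rw [L.post_π_zero]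
      rw [e, L.termMult_term, termEndofunctors_map_app_term, L.cat.one_comp])
    (fun m X => ConcreteCategory.hom_ext _ _ fun y => by
      obtain ⟨n, f, x, rfl⟩ := L.exists_term y
      change (L.termEndofunctors.map (ρ_ m).hom).app X (L.termMult m (𝟙_ M) X
        (L.term f fun i => L.term (L.cat.one 1) fun _ => x i)) = L.term f x
      -- The family of variables is the family of components of the identity of `n`.
      have e : (fun i => L.term (L.cat.one 1) fun _ => x i) =
          fun i => L.term (L.cat.post (L.π i) (L.cat.one n)) x := by
        funext i
        rw [L.cat.post_one, L.term_π]
      rw [e, L.termMult_term, termEndofunctors_map_app_term, L.cat.comp_one])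

/-! ### Comparison of `L` with the theory of its terms. -/

/-- The operation `π_i ∘ f` as a term in the variables. -/
def toTerm (f : (L.cat.Hom n n').obj m) (i : Fin n') : L.Term m (ULift.{u} (Fin n)) :=
  L.term (L.cat.post (L.π i) f) ULift.up

lemma copowEquiv_map (F : M ⥤ Type u) (w : m ⟶ m') (a : (rightHom (copow M n) F).obj m) (i : Fin n) :
    copowEquiv F m' ((rightHom (copow M n) F).map w a) i = F.map w (copowEquiv F m a i) := by
  change F.map _ (F.map (𝟙_ M ◁ w) (rightHom.ev a _ _)) = F.map _ (F.map _ (rightHom.ev a _ _))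
  simp only [← Functor.map_comp_apply]
  simp

/-- By the Yoneda lemma, each component of a morphism of arities is a projection coerced along a map
`I ⟶ m`; `J` is natural in the grade. -/
lemma post_π_J (φ : ((arityCat M).Hom n n').obj m) (i : Fin n') :
    L.cat.post (L.π i) ((L.J.map n n').app m φ) =
      (L.cat.Hom n 1).map (copowEquiv (copow M n) m φ i).2
        (L.π (copowEquiv (copow M n) m φ i).1) := by
  refine (L.J.toEnrFunctor.map_post _ _).symm.trans ?_
  refine Eq.trans ?_ ((L.J.map n 1).naturality_apply _ _)
  refine congrArg ((L.J.map n 1).app m) ?_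
  apply (copowEquiv (copow M n) m).injective
  refine (copowEquiv_post_arityMap (fun _ : Fin 1 => i) φ).trans (funext fun j => Eq.symm ?_)
  refine (copowEquiv_map (copow M n) _ _ j).trans ?_
  refine (congrArg _ (congrFun ((copowEquiv (copow M n) (𝟙_ M)).apply_symm_apply _) j)).trans ?_
  exact Prod.ext rfl (Category.id_comp _)

/-- The comparison morphism from `L` to the graded Lawvere theory of its terms. -/
noncomputable def toTermTheory : L ⟶ lawvereObj L.termMonad where
  functor :=
    { map := fun n n' =>
        { app := fun m => ↾fun f => ↾fun i : ULift.{u} (Fin n') => L.toTerm f i.down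
          naturality := fun m m' w => ConcreteCategory.hom_ext _ _ fun f =>
            lawvereCat.ext (T := L.termMonad) fun i => by
              change L.term (L.cat.post (L.π i.down) ((L.cat.Hom n n').map w f)) ULift.up =
                L.term ((L.cat.Hom n 1).map w (L.cat.post (L.π i.down) f)) ULift.up
              rw [L.cat.post_map] }
      map_one := fun n => lawvereCat.ext (T := L.termMonad) fun i => by
        change L.term (L.cat.post (L.π i.down) (L.cat.one n)) ULift.up =
          L.term (L.cat.one 1) fun _ => i
        rw [L.cat.post_one, L.term_π]
      map_comp := fun {X Y Z m₁ m₂} g f => lawvereCat.ext (T := L.termMonad) fun i => by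
        change L.term (L.cat.post (L.π i.down) (L.cat.comp g f)) ULift.up =
          L.termMult m₁ m₂ _ (L.term (L.cat.post (L.π i.down) g) fun j =>
            L.term (L.cat.post (L.π j) f) ULift.up)
        rw [L.termMult_term, L.cat.comp_post] }
  comm := by
    ext1
    funext n n'
    ext m φ
    refine lawvereCat.ext (T := L.termMonad) fun i => ?_
    change L.term (L.cat.post (L.π i.down) ((L.J.map n n').app m φ)) ULift.up =
      L.term ((L.cat.Hom 1 1).map (copowEquiv (copow M n) m φ i.down).2 (L.cat.one 1))
        fun _ => ⟨(copowEquiv (copow M n) m φ i.down).1⟩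
    rw [L.post_π_J, ← termEndofunctors_map_app_term, L.term_π]
    rfl

lemma term_up_bijective (n : ℕ) (m : M) :
    Function.Bijective fun f : (L.cat.Hom n 1).obj m => L.term f (ULift.up.{u} : Fin n → _) := by
  refine ⟨fun f f' h => ?_, fun y => ?_⟩
  · obtain ⟨k, e, σ, τ, -, h₁, h₂, h₃⟩ := L.term_eq_term_iff.1 h
    -- The map `i ↦ (e i).down` is a retraction of both `σ` and `τ`, so renaming along it recovers
    -- `f` and `f'`.
    have h := congrArg (fun a => L.cat.pre a (L.base fun i => (e i).down)) h₃
    simp only [base_base_pre, h₁, h₂, base_id] at h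
    simpa only [EnrCat.pre, L.cat.comp_one] using h
  · obtain ⟨k, f, x, rfl⟩ := L.exists_term y
    exact ⟨L.cat.pre f (L.base fun i => (x i).down), L.term_pre _ f _⟩

lemma toTermTheory_bijective (n : ℕ) (m : M) :
    Function.Bijective ((L.toTermTheory.functor.map n 1).app m) := by
  have h : (fun f : (L.cat.Hom n 1).obj m => L.term f (ULift.up.{u} : Fin n → _)) =
      opOf L.toTermTheory := funext fun f =>
    congrArg (fun a => L.term a (ULift.up.{u} : Fin n → _)) (L.post_π_zero f).symm
  have hb := L.term_up_bijective n m
  rw [h] at hb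
  refine ⟨fun f g hfg => hb.1 (congrArg (fun a => lawvereCat.toMap a ⟨0⟩) hfg), fun a => ?_⟩
  obtain ⟨f, hf⟩ := hb.2 (lawvereCat.toMap a ⟨0⟩)
  refine ⟨f, ?_⟩
  rw [← toOp_opOf, hf]
  exact toOp_toMap _ _

variable {L}

/-- Morphisms into `n` are families of operations on both sides, and `φ` respects the projections.
-/
lemma Hom.map_bijective {L' : GLaw M} (φ : L ⟶ L')
    (h : ∀ (n : ℕ) (m : M), Function.Bijective ((φ.functor.map n 1).app m)) (k n : ℕ) (m : M) :
    Function.Bijective ((φ.functor.map k n).app m) := by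
  have e (f : (L.cat.Hom k n).obj m) (i : Fin n) :
      L'.cat.post (L'.π i) ((φ.functor.map k n).app m f) =
        (φ.functor.map k 1).app m (L.cat.post (L.π i) f) := by
    refine Eq.symm ((φ.functor.toEnrFunctor.map_post _ _).trans ?_)
    exact congrArg (fun a => L'.cat.post a _) (φ.map_J _)
  refine ⟨fun f g hfg => L.hom_ext fun i => (h k m).1 ?_, fun a => ?_⟩
  · rw [← e, ← e, hfg]
  · choose b hb using fun i => (h k m).2 (L'.cat.post (L'.π i) a)
    obtain ⟨f, hf⟩ := (L.π_bijective k n m).2 b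
    refine ⟨f, L'.hom_ext fun i => ?_⟩
    rw [e, ← hb, ← congrFun hf i]

lemma Hom.isIso_of_bijective {L' : GLaw M} (φ : L ⟶ L')
    (h : ∀ (n : ℕ) (m : M), Function.Bijective ((φ.functor.map n 1).app m)) : IsIso φ := by
  let E (k n : ℕ) (m : M) := Equiv.ofBijective _ (Hom.map_bijective φ h k n m)
  have hE (k n : ℕ) (m : M) (f : (L.cat.Hom k n).obj m) :
      E k n m f = (φ.functor.map k n).app m f := rfl
  let ψ : IdObjFunctor L'.cat L.cat :=
    { map := fun k n =>
        { app := fun m => ↾(E k n m).symm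
          naturality := fun m m' w => ConcreteCategory.hom_ext _ _ fun a => by
            change (E k n m').symm ((L'.cat.Hom k n).map w a) =
              (L.cat.Hom k n).map w ((E k n m).symm a)
            rw [Equiv.symm_apply_eq, hE, NatTrans.naturality_apply, ← hE, Equiv.apply_symm_apply] }
      map_one := fun n => by
        change (E n n (𝟙_ M)).symm (L'.cat.one n) = L.cat.one n
        rw [Equiv.symm_apply_eq, hE, φ.functor.map_one]
      map_comp := fun {X Y Z m₁ m₂} g f => by
        change (E X Z (m₁ ⊗ m₂)).symm (L'.cat.comp g f) =
          L.cat.comp ((E Y Z m₁).symm g) ((E X Y m₂).symm f)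
        rw [Equiv.symm_apply_eq, hE, φ.functor.map_comp, ← hE, ← hE, Equiv.apply_symm_apply,
          Equiv.apply_symm_apply] }
  refine ⟨⟨ψ, ?_⟩, ?_, ?_⟩
  · ext1
    funext k n
    refine NatTrans.ext (funext fun m => ConcreteCategory.hom_ext _ _ fun a => ?_)
    change (E k n m).symm ((L'.J.map k n).app m a) = (L.J.map k n).app m a
    rw [Equiv.symm_apply_eq, hE, φ.map_J]
  · apply GLaw.Hom.ext; ext1; funext k n
    exact NatTrans.ext (funext fun m => ConcreteCategory.hom_ext _ _ fun a =>
      (E k n m).symm_apply_apply a)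
  · apply GLaw.Hom.ext; ext1; funext k n
    exact NatTrans.ext (funext fun m => ConcreteCategory.hom_ext _ _ fun a =>
      (E k n m).apply_symm_apply a)

lemma Hom.bijective_of_isIso {L' : GLaw M} (φ : L ⟶ L') [IsIso φ] (k n : ℕ) (m : M) :
    Function.Bijective ((φ.functor.map k n).app m) := by
  refine Function.bijective_iff_has_inverse.2 ⟨((inv φ).functor.map k n).app m, fun f => ?_,
    fun f => ?_⟩
  · exact congrArg (fun G : L ⟶ L => (G.functor.map k n).app m f) (IsIso.hom_inv_id φ)
  · exact congrArg (fun G : L' ⟶ L' => (G.functor.map k n).app m f) (IsIso.inv_hom_id φ)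

end GLaw

instance : (lawvereFunctor M).EssSurj where
  mem_essImage L := by
    have := GLaw.Hom.isIso_of_bijective L.toTermTheory L.toTermTheory_bijective
    exact ⟨L.termMonad, ⟨(asIso L.toTermTheory).symm⟩⟩

end TermMonadConstruction

end GradedTheory

theorem mainTheorem2 (M : Type u) [CategoryTheory.SmallCategory M]
    [CategoryTheory.MonoidalCategory M] :
    (GradedTheory.lawvereFunctor M).Full ∧
      (GradedTheory.lawvereFunctor M).Faithful ∧
      (GradedTheory.lawvereFunctor M).EssSurj ∧
      ∃ e : GradedTheory.GMnd M ≌ GradedTheory.GLaw M,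
        e.functor = GradedTheory.lawvereFunctor M ∧
          ∀ L : GradedTheory.GLaw M, Nonempty (GradedTheory.TermMonad L (e.inverse.obj L)) := by
  -- The three fields are filled by the instances for fullness, faithfulness and essential
  -- surjectivity.
  have : (GradedTheory.lawvereFunctor M).IsEquivalence := { }
  refine ⟨inferInstance, inferInstance, inferInstance,
    (GradedTheory.lawvereFunctor M).asEquivalence, rfl, fun L => ?_⟩
  -- The inverse of the counit identifies `L` with the theory of `e.inverse.obj L`; being an
  -- isomorphism, it is bijective on operations.
  let φ : L ⟶ GradedTheory.lawvereObj ((GradedTheory.lawvereFunctor M).asEquivalence.inverse.obj L) :=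
    (GradedTheory.lawvereFunctor M).asEquivalence.counitIso.inv.app L
  have : IsIso φ := inferInstanceAs
    (IsIso ((GradedTheory.lawvereFunctor M).asEquivalence.counitIso.inv.app L))
  exact ⟨GradedTheory.termMonadOfBijective φ fun n m =>
    GradedTheory.GLaw.Hom.bijective_of_isIso φ n 1 m⟩
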